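/- Let $p$ be a prime, let $R$ be a commutative ring and let $a,b\in R$. Definitions. Let $S/R$ be an extension of commutative rings and $\sigma$ an $R$-automorphism of $S$ with $\sigma^n=1$. $S/R$ is cyclic Galois of degree $n$ with generator $\sigma$ if $S$ is finitely generated projective over $R$ and the map $\bigoplus_{i=0}^{n-1}S\sigma^i\to \mathrm{End}_R(S)$ from the twisted group ring, $\sum c_i\sigma^i\mapsto (t\mapsto\sum c_i\sigma^i(t))$, is an isomorphism. For an $S$-module $J$ let $\tau(J)$ be $J$ with $s\in S$ acting as $\tau^{-1}(s)$. If $J$ is a rank one projective $S$-module and $\phi: J\otimes_S\sigma(J)\otimes_S\cdots\otimes_S\sigma^{n-1}(J)\cong S$ is an $S$-linear isomorphism commuting with the actions of $\sigma$ (on the left side $\sigma$ sends $j_0\otimes\cdots\otimes j_{n-1}$ to $j_{n-1}\otimes j_0\otimes\cdots\otimes j_{n-2}$), let $\Delta(S/R,\sigma,J,\phi)$ be the quotient of the twisted tensor ring $S\oplus Jt\oplus (Jt)^2\oplus\cdots$, in which $ts=\sigma(s)t$ and $(Jt)^n\cong J\otimes_S\sigma(J)\otimes_S\cdots\otimes_S\sigma^{n-1}(J)$,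 by the ideal generated by all $x-\phi(x)$, $x\in (Jt)^n$. An $R$-algebra $A$ is almost cyclic of degree $n$ with respect to a subalgebra $S\subset A$ if $S$ is commutative and cyclic Galois of degree $n$ over $R$ with some generator $\sigma$ and, for some $J$, $\phi$ as above, there is an $R$-algebra isomorphism $\Delta(S/R,\sigma,J,\phi)\cong A$ that is the identity on $S$. (1) Suppose $pR=0$, and let $(a,b)$ be the $R$-algebra generated by $x,y$ subject to $xy-yx=1$, $x^p=a$, $y^p=b$. Then $(a,b)$ is free over $R$ with basis $x^iy^j$, $0\le i,j\le p-1$; it is almost cyclic of degree $p$ with respect to $R[xy]$, and it is Azumaya over $R$. (2) Suppose $R$ is an algebra over $\mathbb Z[\rho]$, where $\rho$ is a primitive $p$-th root of one ($\rho=-1$ if $p=2$). Write $\rho$ also for its image in $R$ and put $\eta=\rho-1$. Let $(a,b)_\rho$ be the $R$-algebra generated by $x,y$ subject to $xy-\rho yx=1$, $x^p=a$, $y^p=b$. Put $d=1+ab\eta^p$ if $p$ is odd, and $d=1-ab\eta^2=1-4ab$ if $p=2$. Then: (i) $(a,b)_\rho$ is free over $R$ of rank $p^2$, with basis $x^iy^j$,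 $0\le i,j\le p-1$. (ii) If $d$ is a unit of $R$, then $(a,b)_\rho$ is almost cyclic of degree $p$ with respect to $R[xy]$. (iii) $(a,b)_\rho$ is Azumaya over $R$ if and only if $d$ is a unit of $R$. (iv) Let $\hat R=R/\eta R$ and let $\hat a,\hat b$ be the images of $a,b$ in $\hat R$ (so $p\hat R=0$). Then $(\hat a,\hat b)$ is Azumaya over $\hat R$, and there is an isomorphism of $\hat R$-algebras $(a,b)_\rho/\eta(a,b)_\rho=\hat R\otimes_R(a,b)_\rho\cong(\hat a,\hat b)$ sending $x$ to $x$ and $y$ to $y$. -/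

import Mathlib

open scoped TensorProduct

universe u v w

/-! ### The algebras `(a, b)` and `(a, b)_ρ` -/

/-- `ℤ[ρ] = ℤ[Z] / (Z ^ (p - 1) + ⋯ + Z + 1)`, for `p` prime and `ρ` a primitive `p`-th root
of one. A commutative ring "contains `ρ`" when it is an algebra over this ring. -/
abbrev ZRho (p : ℕ) : Type := AdjoinRoot (Polynomial.cyclotomic p ℤ)

/-- The image of `ρ` in a `ℤ[ρ]`-algebra `R`. -/
noncomputable def rhoIn (p : ℕ) (R : Type u) [CommRing R] [Algebra (ZRho p) R] : R :=
  algebraMap (ZRho p) R (AdjoinRoot.root (Polynomial.cyclotomic p ℤ))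

/-- The image of `η = ρ - 1` in a `ℤ[ρ]`-algebra `R`. -/
noncomputable def etaIn (p : ℕ) (R : Type u) [CommRing R] [Algebra (ZRho p) R] : R :=
  rhoIn p R - 1

/-- The ring `R / ηR`. -/
abbrev RHat (p : ℕ) (R : Type u) [CommRing R] [Algebra (ZRho p) R] : Type u :=
  R ⧸ Ideal.span {etaIn p R}

/-- The image of `r` in `R / ηR`. -/
def hat (p : ℕ) {R : Type u} [CommRing R] [Algebra (ZRho p) R] (r : R) : RHat p R :=
  Ideal.Quotient.mk (Ideal.span {etaIn p R}) r

section Presented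

variable {R : Type u} [CommRing R]

/-- The relations `xy - q yx = 1`, `x ^ p = a`, `y ^ p = b` on the free algebra on
`x = ι 0` and `y = ι 1`. -/
inductive QWeylRel (p : ℕ) (q a b : R) : FreeAlgebra R (Fin 2) → FreeAlgebra R (Fin 2) → Prop
  | comm : QWeylRel p q a b
      (FreeAlgebra.ι R 0 * FreeAlgebra.ι R 1 - q • (FreeAlgebra.ι R 1 * FreeAlgebra.ι R 0)) 1
  | x_pow : QWeylRel p q a b (FreeAlgebra.ι R 0 ^ p) (algebraMap R _ a)
  | y_pow : QWeylRel p q a b (FreeAlgebra.ι R 1 ^ p) (algebraMap R _ b)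

/-- The `R`-algebra generated by `x`, `y` subject to `xy - q yx = 1`, `x ^ p = a`, `y ^ p = b`. -/
abbrev QWeyl (p : ℕ) (q a b : R) : Type u := RingQuot (QWeylRel p q a b)

/-- The generator `x`. -/
noncomputable def QWeyl.x (p : ℕ) (q a b : R) : QWeyl p q a b :=
  RingQuot.mkAlgHom R (QWeylRel p q a b) (FreeAlgebra.ι R 0)

/-- The generator `y`. -/
noncomputable def QWeyl.y (p : ℕ) (q a b : R) : QWeyl p q a b :=
  RingQuot.mkAlgHom R (QWeylRel p q a b) (FreeAlgebra.ι R 1)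

/-- The differential crossed product `(a, b)`: generated by `x`, `y` subject to
`xy - yx = 1`, `x ^ p = a`, `y ^ p = b` (used when `p = 0` in `R`). -/
abbrev DiffCrossed (p : ℕ) (a b : R) : Type u := QWeyl p 1 a b

/-- The algebra `(a, b)_ρ`: generated by `x`, `y` subject to
`xy - ρ yx = 1`, `x ^ p = a`, `y ^ p = b`. -/
abbrev RhoAlgebra (p : ℕ) [Algebra (ZRho p) R] (a b : R) : Type u := QWeyl p (rhoIn p R) a b

/-- The monomials `x ^ i y ^ j`, `0 ≤ i, j ≤ p - 1`, form an `R`-basis. -/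
def HasMonomialBasis (p : ℕ) (q a b : R) : Prop :=
  ∃ B : Module.Basis (Fin p × Fin p) R (QWeyl p q a b),
    ∀ i j : Fin p, B (i, j) = QWeyl.x p q a b ^ (i : ℕ) * QWeyl.y p q a b ^ (j : ℕ)

/-- The subalgebra `R[xy]`. -/
noncomputable def QWeyl.adjoinXY (p : ℕ) (q a b : R) : Subalgebra R (QWeyl p q a b) :=
  Algebra.adjoin R {QWeyl.x p q a b * QWeyl.y p q a b}

end Presented

/-! ### Cyclic Galois extensions and almost cyclic algebras -/

/-- `S/R` is Galois with cyclic group of order `n` generated by `σ`: `S` is a finitely generated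
projective extension of `R` and the map from the twisted group ring `⨁ S σ ^ i` to `End_R(S)`,
sending `∑ c i σ ^ i` to `t ↦ ∑ c i * (σ ^ i) t`, is an isomorphism. -/
structure IsCyclicGalois (R : Type u) (S : Type v) [CommRing R] [CommRing S] [Algebra R S]
    (n : ℕ) (σ : S ≃ₐ[R] S) : Prop where
  injective : Function.Injective (algebraMap R S)
  finite : Module.Finite R S
  projective : Module.Projective R S
  pow_eq_one : σ ^ n = 1
  bijective : Function.Bijective (fun c : Fin n → S =>
    (∑ i : Fin n, LinearMap.mulLeft R (c i) ∘ₗ (σ ^ (i : ℕ)).toLinearMap : Module.End R S))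

section Delta

variable {R : Type u} {S : Type v} [CommRing R] [CommRing S] [Algebra R S]

/-- The twist `τ(J)` of an `S`-module: the group `J` with `s` acting as `τ⁻¹ s`. -/
def Twist (_τ : S ≃ₐ[R] S) (J : Type w) : Type w := J

instance (τ : S ≃ₐ[R] S) (J : Type w) [AddCommGroup J] : AddCommGroup (Twist τ J) :=
  inferInstanceAs (AddCommGroup J)

instance (τ : S ≃ₐ[R] S) (J : Type w) [AddCommGroup J] [Module S J] : Module S (Twist τ J) :=
  Module.compHom J (τ.symm : S →+* S)

/-- The identity map `J → τ(J)`. -/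
def Twist.mk (τ : S ≃ₐ[R] S) {J : Type w} (j : J) : Twist τ J := j

/-- `(J t) ^ n = J ⊗ σ(J) ⊗ ⋯ ⊗ σ ^ (n - 1) (J)`, the tensor products being over `S`. -/
abbrev TwistPow (σ : S ≃ₐ[R] S) (n : ℕ) (J : Type w) [AddCommGroup J] [Module S J] :
    Type (max v w) :=
  PiTensorProduct S (fun i : Fin n => Twist (σ ^ (i : ℕ)) J)

/-- The element `(j₀ t) (j₁ t) ⋯ (jₙ₋₁ t)` of `(J t) ^ n`. -/
def TwistPow.mk (σ : S ≃ₐ[R] S) {n : ℕ} {J : Type w} [AddCommGroup J] [Module S J]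
    (j : Fin n → J) : TwistPow σ n J :=
  PiTensorProduct.tprod S (fun i : Fin n => Twist.mk (σ ^ (i : ℕ)) (j i))

/-- `φ` preserves the action of the group generated by `σ`. As `σ ^ n = 1`, the generator acts on
`J ⊗ σ(J) ⊗ ⋯ ⊗ σ ^ (n - 1) (J)` by `j₀ ⊗ j₁ ⊗ ⋯ ⊗ jₙ₋₁ ↦ jₙ₋₁ ⊗ j₀ ⊗ ⋯ ⊗ jₙ₋₂`. -/
def PreservesAction {σ : S ≃ₐ[R] S} {n : ℕ} {J : Type w} [AddCommGroup J] [Module S J]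
    (φ : TwistPow σ n J ≃ₗ[S] S) : Prop :=
  ∀ j : Fin n → J,
    φ (TwistPow.mk σ (fun i => j ((finRotate n).symm i))) = σ (φ (TwistPow.mk σ j))

/-- The relations defining `Δ(S/R, σ, J, φ)` on the free `R`-algebra on the elements of `S` and of
`J`, an element `j` of `J` standing for `j t`. All but the last present the tensor ring
`S ⊕ J t ⊕ (J t) ^ 2 ⊕ ⋯`, in which `t s = σ(s) t`; the last one is `x = φ x` on `(J t) ^ n`. -/
inductive DeltaRel (σ : S ≃ₐ[R] S) {n : ℕ} {J : Type w} [AddCommGroup J] [Module S J]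
    (φ : TwistPow σ n J ≃ₗ[S] S) : FreeAlgebra R (S ⊕ J) → FreeAlgebra R (S ⊕ J) → Prop
  | base_algebraMap (r : R) : DeltaRel σ φ
      (FreeAlgebra.ι R (Sum.inl (algebraMap R S r))) (algebraMap R _ r)
  | base_add (s s' : S) : DeltaRel σ φ
      (FreeAlgebra.ι R (Sum.inl (s + s')))
      (FreeAlgebra.ι R (Sum.inl s) + FreeAlgebra.ι R (Sum.inl s'))
  | base_mul (s s' : S) : DeltaRel σ φ
      (FreeAlgebra.ι R (Sum.inl (s * s')))
      (FreeAlgebra.ι R (Sum.inl s) * FreeAlgebra.ι R (Sum.inl s'))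
  | mod_add (j j' : J) : DeltaRel σ φ
      (FreeAlgebra.ι R (Sum.inr (j + j')))
      (FreeAlgebra.ι R (Sum.inr j) + FreeAlgebra.ι R (Sum.inr j'))
  | left_smul (s : S) (j : J) : DeltaRel σ φ
      (FreeAlgebra.ι R (Sum.inl s) * FreeAlgebra.ι R (Sum.inr j))
      (FreeAlgebra.ι R (Sum.inr (s • j)))
  | right_smul (s : S) (j : J) : DeltaRel σ φ
      (FreeAlgebra.ι R (Sum.inr j) * FreeAlgebra.ι R (Sum.inl s))
      (FreeAlgebra.ι R (Sum.inr (σ s • j)))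
  | norm (j : Fin n → J) : DeltaRel σ φ
      (List.ofFn (fun i => FreeAlgebra.ι R (Sum.inr (j i) : S ⊕ J))).prod
      (FreeAlgebra.ι R (Sum.inl (φ (TwistPow.mk σ j))))

/-- The algebra `Δ(S/R, σ, J, φ)`. -/
abbrev Delta (σ : S ≃ₐ[R] S) {n : ℕ} {J : Type w} [AddCommGroup J] [Module S J]
    (φ : TwistPow σ n J ≃ₗ[S] S) : Type (max u v w) :=
  RingQuot (DeltaRel σ φ)

/-- The canonical map `S → Δ(S/R, σ, J, φ)`. -/
noncomputable def Delta.ofBase (σ : S ≃ₐ[R] S) {n : ℕ} {J : Type w} [AddCommGroup J] [Module S J]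
    (φ : TwistPow σ n J ≃ₗ[S] S) (s : S) : Delta σ φ :=
  RingQuot.mkAlgHom R (DeltaRel σ φ) (FreeAlgebra.ι R (Sum.inl s))

end Delta

/-- The `R`-algebra `A` is almost cyclic of degree `n` with respect to its subalgebra `S'`:
`S'` is (a copy of) a cyclic Galois extension `S/R` of degree `n` with generator `σ`, and there are
a rank one projective `S`-module `J`, a group preserving isomorphism `φ : (J t) ^ n ≅ S`, and an
isomorphism `Δ(S/R, σ, J, φ) ≅ A` of `R`-algebras that carries `S` to `S'`. -/
def IsAlmostCyclic (R : Type u) {A : Type v} [CommRing R] [Ring A] [Algebra R A] (n : ℕ)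
    (S' : Subalgebra R A) : Prop :=
  ∃ (S : Type v) (_ : CommRing S) (_ : Algebra R S) (e : S ≃ₐ[R] S') (σ : S ≃ₐ[R] S)
    (J : Type v) (_ : AddCommGroup J) (_ : Module S J) (φ : TwistPow σ n J ≃ₗ[S] S),
    IsCyclicGalois R S n σ ∧ Module.Invertible S J ∧ PreservesAction φ ∧
      ∃ Ψ : Delta σ φ ≃ₐ[R] A, ∀ s : S, Ψ (Delta.ofBase σ φ s) = (e s : A)

/-! Both algebras have the relation xy - q yx = 1 with [p] = 1 + q + ⋯ + q^(p-1) = 0: q = 1 when p =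
0 in R, and q = ρ over ℤ[ρ]. One argument under the sole hypothesis [p] = 0 therefore covers both.
Sending ρ to q maps ℤ[ρ] to R, so identities and units of ℤ[ρ] transfer; in particular [i] is a unit
for 0 < i < p (`isUnit_qInt`).

The monomials x^i y^j span by straightening, and are independent because a regular representation on
a free module of rank p² can be written down (`QWeyl.linearIndependent_monomials`). Giving x degree
1 and y degree -1 grades the algebra A by ℤ/p. Its degree zero part is S = R[z] with z = xy and ∏
([i] + q^i z) = ab, and conjugation by x induces σ(z) = 1 + qz. The grading is strong whatever d is:
xy and y^(p-1) x^(p-1) both lie in A₁A₋₁ and are comaximal in S (`QWeyl.one_mem_gradedPart_mul`).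

The unit d enters through (1 + (q-1)z)^p = d and σ^j z - σ^i z = q^i [j-i] (1 + (q-1)z). If d is a
unit, the Vandermonde matrix of the conjugates of z is invertible, so S/R is cyclic Galois
(`QBase.isCyclicGalois`).

The rest is general. In a strong ℤ/p-grading with commutative degree zero part twisted by σ, the
products km and mk of k in A₁ and m in A₋₁ satisfy km = σ(mk) (`CyclicGrading.mul_eq_σ_mul`). Hence
A₁ is invertible, multiplication gives an equivariant φ, and Δ maps isomorphically to A
(`CyclicGrading.isAlmostCyclic`). When S/R is Galois with a separability element and A is free of
finite rank, left and right multiplications yield all of End_R(A), so A is Azumaya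
(`CyclicGrading.isAzumaya`).

Conversely θ = 1 + (q-1)xy satisfies Aθ ⊆ θA. If A is Azumaya, every R-endomorphism is a combination
of two-sided multiplications and so sends θ into θA; the endomorphism taking the coefficient of 1
shows 1 ∈ θA, and p-th powers make d = θ^p a unit (`QWeyl.isUnit_of_isAzumaya`). -/

/-! ### Algebras with a cyclic grading -/

/-- A strong grading of the `R`-algebra `A` by `ZMod p` whose part of degree zero is (a copy of)
the commutative ring `S`, an element of degree `k` commuting with `S` up to `σ ^ k`. -/
structure CyclicGrading {R S : Type*} (A : Type*) [CommRing R] [CommRing S] [Algebra R S] [Ring A]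
    [Algebra R A] (p : ℕ) (σ : S ≃ₐ[R] S) where
  /-- The inclusion of the part of degree zero. -/
  ι : S →ₐ[R] A
  /-- The homogeneous parts. -/
  part : ZMod p → Submodule R A
  pow_eq_one : σ ^ p = 1
  injective : Function.Injective ι
  mem_zero : ∀ v, v ∈ part 0 ↔ ∃ s, ι s = v
  mul_mem : ∀ {i j v w}, v ∈ part i → w ∈ part j → v * w ∈ part (i + j)
  comm : ∀ {k v}, v ∈ part k → ∀ s, v * ι s = ι ((σ ^ k.val) s) * v
  one_mem : 1 ∈ part 1 * part (-1)
  indep : ∀ f : ZMod p → A, (∀ k, f k ∈ part k) → (∑ᶠ k, f k) = 0 → ∀ k, f k = 0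
  iSup_part : ⨆ k, part k = ⊤

namespace CyclicGrading

section Basic

variable {R S A : Type*} [CommRing R] [CommRing S] [Algebra R S] [Ring A] [Algebra R A] {p : ℕ}
  {σ : S ≃ₐ[R] S} (G : CyclicGrading A p σ)
include G

lemma mul_le (i j : ZMod p) : G.part i * G.part j ≤ G.part (i + j) :=
  Submodule.mul_le.2 fun _ hv _ hw => G.mul_mem hv hw

lemma ι_mem (s : S) : G.ι s ∈ G.part 0 := (G.mem_zero _).2 ⟨s, rfl⟩

lemma ι_mul_mem (s : S) {k : ZMod p} {v : A} (hv : v ∈ G.part k) : G.ι s * v ∈ G.part k := by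
  simpa using G.mul_mem (G.ι_mem s) hv

lemma mul_mem_zero {k : ZMod p} {v w : A} (hv : v ∈ G.part k) (hw : w ∈ G.part (-k)) :
    ∃ s, G.ι s = v * w := by
  rw [← G.mem_zero]
  simpa using G.mul_mem hv hw

lemma one_mem_natCast (n : ℕ) : 1 ∈ G.part (n : ZMod p) * G.part (-(n : ZMod p)) := by
  induction n with
  | zero =>
    have h1 : (1 : A) ∈ G.part 0 := by simpa using G.ι_mem 1
    simpa using Submodule.mul_mem_mul h1 h1
  | succ n ih =>
    have key : G.part (n : ZMod p) * G.part (-(n : ZMod p)) ≤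
        G.part ((n + 1 : ℕ) : ZMod p) * G.part (-((n + 1 : ℕ) : ZMod p)) := by
      calc G.part (n : ZMod p) * G.part (-(n : ZMod p))
          = G.part (n : ZMod p) * 1 * G.part (-(n : ZMod p)) := by rw [mul_one]
        _ ≤ G.part (n : ZMod p) * (G.part 1 * G.part (-1)) * G.part (-(n : ZMod p)) := by
            gcongr
            exact Submodule.one_le.2 G.one_mem
        _ = (G.part (n : ZMod p) * G.part 1) * (G.part (-1) * G.part (-(n : ZMod p))) := by
            simp only [mul_assoc]
        _ ≤ _ := by
            refine mul_le_mul' ((G.mul_le _ _).trans_eq ?_) ((G.mul_le _ _).trans_eq ?_)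
            · push_cast; rfl
            · congr 1; push_cast; ring
    exact key ih

/-- Every residue is the class of a natural number, so strongness in degree 1 propagates to all
degrees; k = -1 gives the product in the opposite order, A₋₁A₁. -/
lemma one_mem_mul_neg [NeZero p] (k : ZMod p) : 1 ∈ G.part k * G.part (-k) := by
  simpa using G.one_mem_natCast k.val

lemma part_add_one_le [NeZero p] (k : ZMod p) : G.part (k + 1) ≤ G.part k * G.part 1 := by
  calc G.part (k + 1) = G.part (k + 1) * 1 := (mul_one _).symm
    _ ≤ G.part (k + 1) * (G.part (-1) * G.part (- -1)) := by
        gcongr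
        exact Submodule.one_le.2 (G.one_mem_mul_neg (-1))
    _ = G.part (k + 1) * G.part (-1) * G.part 1 := by rw [mul_assoc, neg_neg]
    _ ≤ _ := by
        gcongr
        exact (G.mul_le _ _).trans_eq (by congr 1; ring)

lemma part_natCast_le_pow [NeZero p] (n : ℕ) : G.part ((n + 1 : ℕ) : ZMod p) ≤ G.part 1 ^ (n + 1) := by
  induction n with
  | zero => simp
  | succ n ih =>
    rw [pow_succ, Nat.cast_succ]
    exact (G.part_add_one_le _).trans (mul_le_mul' ih le_rfl)

lemma pow_le_part (n : ℕ) : G.part 1 ^ n ≤ G.part (n : ZMod p) := by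
  induction n with
  | zero =>
    rw [pow_zero, Nat.cast_zero]
    exact Submodule.one_le.2 (by simpa using G.ι_mem 1)
  | succ n ih =>
    rw [pow_succ, Nat.cast_succ]
    exact (mul_le_mul' ih le_rfl).trans (G.mul_le _ _)

lemma comm_one [Fact p.Prime] {v : A} (hv : v ∈ G.part 1) (s : S) : v * G.ι s = G.ι (σ s) * v := by
  have : Fact (1 < p) := ⟨(Fact.out : p.Prime).one_lt⟩
  simpa [ZMod.val_one] using G.comm hv s

lemma comm_neg_one [Fact p.Prime] {v : A} (hv : v ∈ G.part (-1)) (s : S) :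
    v * G.ι s = G.ι (σ.symm s) * v := by
  have h : (-1 : ZMod p).val + 1 = p := by
    obtain ⟨n, rfl⟩ := Nat.exists_eq_succ_of_ne_zero (Fact.out : p.Prime).ne_zero
    rw [ZMod.val_neg_one]
  have h' : σ ^ (-1 : ZMod p).val = σ⁻¹ := by
    rw [eq_inv_iff_mul_eq_one, ← pow_succ, h, G.pow_eq_one]
  rw [G.comm hv, h']
  rfl

lemma eq_zero_of_mul_part {k : ZMod p} [NeZero p] {c : A} (h : ∀ v ∈ G.part k, c * v = 0) :
    c = 0 := by
  have : ∀ w ∈ G.part k * G.part (-k), c * w = 0 := fun w hw => by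
    induction hw using Submodule.mul_induction_on' with
    | mem_mul_mem m hm n hn => rw [← mul_assoc, h m hm, zero_mul]
    | add x _ y _ hx hy => rw [mul_add, hx, hy, add_zero]
  simpa using this 1 (G.one_mem_mul_neg k)

/-- The products `v w` and `w v` in degree zero are conjugate under `σ`. -/
lemma mul_eq_σ_mul [Fact p.Prime] {k m : A} (hk : k ∈ G.part 1) (hm : m ∈ G.part (-1)) {s t : S}
    (hs : G.ι s = k * m) (ht : G.ι t = m * k) : s = σ t := by
  -- Both terms of the difference equal k' m k'.
  have key : ∀ k' ∈ G.part 1, ∀ s' t' : S, G.ι s' = k' * m → G.ι t' = m * k' →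
      G.ι (s' - σ t') * k' = 0 := by
    intro k' hk' s' t' hs' ht'
    rw [map_sub, sub_mul, ← G.comm_one hk', hs', ht', mul_assoc, sub_self]
  -- Polarization of `key`, which is quadratic in k'.
  have lin : ∀ k' ∈ G.part 1, ∀ s' t' : S, G.ι s' = k' * m → G.ι t' = m * k' →
      G.ι (s - σ t) * k' = - (G.ι (s' - σ t') * k) := by
    intro k' hk' s' t' hs' ht'
    have h := key (k + k') (add_mem hk hk') (s + s') (t + t')
      (by rw [map_add, hs, hs', add_mul]) (by rw [map_add, ht, ht', mul_add])
    have h1 := key k hk s t hs ht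
    have h2 := key k' hk' s' t' hs' ht'
    have e : G.ι (s + s' - σ (t + t')) = G.ι (s - σ t) + G.ι (s' - σ t') := by
      rw [← map_add]; congr 1; rw [map_add]; ring
    rw [e, add_mul, mul_add, mul_add, h1, h2, zero_add, add_zero] at h
    exact eq_neg_of_add_eq_zero_left h
  -- The annihilator of s - σ t. The square of every product k' m' lies in it, and 1 is a sum of
  -- such products, so its radical is the unit ideal.
  set I : Ideal S := LinearMap.ker (LinearMap.mulRight S (s - σ t)) with hI
  have hmem : ∀ c, c ∈ I ↔ c * (s - σ t) = 0 := fun c => by simp [hI]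
  have hsq : ∀ k' ∈ G.part 1, ∀ m' ∈ G.part (-1), ∀ c, G.ι c = k' * m' → c ∈ I.radical := by
    intro k' hk' m' hm' c hc
    refine ⟨2, (hmem _).2 (G.injective ?_)⟩
    obtain ⟨s', hs'⟩ := G.mul_mem_zero hk' hm
    obtain ⟨t', ht'⟩ := G.mul_mem_zero (k := -1) hm (by simpa using hk')
    obtain ⟨c', hc'⟩ := G.mul_mem_zero hk hm'
    have e1 : G.ι ((s - σ t) * c) = G.ι (-((s' - σ t') * c')) := by
      rw [map_mul, hc, ← mul_assoc, lin k' hk' s' t' hs' ht', map_neg, map_mul, hc', neg_mul,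
        mul_assoc]
    have e2 : G.ι ((s' - σ t') * c) = 0 := by
      rw [map_mul, hc, ← mul_assoc, key k' hk' s' t' hs' ht', zero_mul]
    have : c ^ 2 * (s - σ t) = -((s' - σ t') * c) * c' := by
      have := G.injective e1
      linear_combination c * this
    rw [this, map_mul, map_neg, e2, neg_zero, zero_mul, map_zero]
  have h1 : ∀ w ∈ G.part 1 * G.part (-1), ∃ c ∈ I.radical, G.ι c = w := by
    intro w hw
    induction hw using Submodule.mul_induction_on' with
    | mem_mul_mem k' hk' m' hm' =>
      obtain ⟨c, hc⟩ := G.mul_mem_zero hk' hm'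
      exact ⟨c, hsq k' hk' m' hm' c hc, hc⟩
    | add x _ y _ hx hy =>
      obtain ⟨c, hc, rfl⟩ := hx
      obtain ⟨d, hd, rfl⟩ := hy
      exact ⟨c + d, add_mem hc hd, map_add _ _ _⟩
  obtain ⟨c, hc, hc1⟩ := h1 1 G.one_mem
  have : c = 1 := G.injective (by rw [hc1, map_one])
  rw [this, ← Ideal.eq_top_iff_one, Ideal.radical_eq_top] at hc
  have := (hmem 1).1 (hc ▸ Submodule.mem_top)
  rw [one_mul] at this
  exact sub_eq_zero.1 this

end Basic

/-! ### The degree one part as an invertible module -/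

section Piece

variable {R S A : Type*} [CommRing R] [CommRing S] [Algebra R S] [Ring A] [Algebra R A] {p : ℕ}
  {σ : S ≃ₐ[R] S} (G : CyclicGrading A p σ)

/-- The part of degree `k` as an `S`-module. -/
def Piece (k : ZMod p) : Type _ := G.part k

instance (k : ZMod p) : AddCommGroup (G.Piece k) := inferInstanceAs (AddCommGroup (G.part k))

/-- The inclusion of a homogeneous part. -/
def incl {k : ZMod p} : G.Piece k →+ A := (G.part k).subtype.toAddMonoidHom

lemma incl_injective {k : ZMod p} : Function.Injective (G.incl (k := k)) :=
  Subtype.val_injective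

lemma incl_mem {k : ZMod p} (j : G.Piece k) : G.incl j ∈ G.part k := Subtype.property j

lemma exists_incl {k : ZMod p} {v : A} (hv : v ∈ G.part k) : ∃ j : G.Piece k, G.incl j = v :=
  ⟨⟨v, hv⟩, rfl⟩

instance (k : ZMod p) : SMul S (G.Piece k) :=
  ⟨fun s j => ⟨G.ι s * G.incl j, G.ι_mul_mem s (G.incl_mem j)⟩⟩

lemma incl_smul {k : ZMod p} (s : S) (j : G.Piece k) : G.incl (s • j) = G.ι s * G.incl j := rfl

instance (k : ZMod p) : Module S (G.Piece k) where
  one_smul j := G.incl_injective (by simp [incl_smul])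
  mul_smul s t j := G.incl_injective (by simp [incl_smul, mul_assoc])
  smul_zero s := G.incl_injective (by simp [incl_smul])
  smul_add s j j' := G.incl_injective (by simp [incl_smul, mul_add])
  add_smul s t j := G.incl_injective (by simp [incl_smul, add_mul])
  zero_smul j := G.incl_injective (by simp [incl_smul])

lemma incl_mul_ι [Fact p.Prime] (j : G.Piece 1) (s : S) :
    G.incl j * G.ι s = G.incl (σ s • j) := by
  rw [incl_smul, G.comm_one (G.incl_mem j)]

/-- The product of elements of opposite degrees, as an element of `S`. -/
noncomputable def pairing {k : ZMod p} (j : G.Piece k) (n : G.Piece (-k)) : S :=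
  (G.mul_mem_zero (G.incl_mem j) (G.incl_mem n)).choose

@[simp]
lemma ι_pairing {k : ZMod p} (j : G.Piece k) (n : G.Piece (-k)) :
    G.ι (G.pairing j n) = G.incl j * G.incl n :=
  (G.mul_mem_zero (G.incl_mem j) (G.incl_mem n)).choose_spec

/-- Linear forms on the part of degree one satisfy `ψ(j) k = ψ(k) j`. -/
lemma dual_apply_smul [Fact p.Prime] (ψ : G.Piece 1 →ₗ[S] S) (j k : G.Piece 1) :
    ψ j • k = ψ k • j := by
  apply G.incl_injective
  rw [← sub_eq_zero]
  refine G.eq_zero_of_mul_part (k := -1) fun n hn => ?_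
  obtain ⟨n, rfl⟩ := G.exists_incl hn
  obtain ⟨t, ht⟩ := G.mul_mem_zero (k := -1) (G.incl_mem n) (by simpa using G.incl_mem j)
  -- Both sides are k n j, bracketed in the two ways. Applying ψ and using jn = σ(nj) compares the
  -- two scalars.
  have h1 : G.pairing k n • j = σ t • k := by
    apply G.incl_injective
    rw [incl_smul, incl_smul, ι_pairing, ← G.comm_one (G.incl_mem k), ht, mul_assoc]
  have h2 : G.pairing j n = σ t :=
    G.mul_eq_σ_mul (G.incl_mem j) (G.incl_mem n) (G.ι_pairing j n) ht
  have h3 : G.pairing k n * ψ j = G.pairing j n * ψ k := by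
    have := congrArg ψ h1
    simpa [h2] using this
  rw [sub_mul, incl_smul, incl_smul, mul_assoc, mul_assoc, ← ι_pairing, ← ι_pairing, ← map_mul,
    ← map_mul, mul_comm, h3, mul_comm, sub_self]

/-- The inverse is A₋₁ twisted by σ: the twist makes multiplication S-bilinear, since j σ⁻¹(s) n = s
j n. The induced map μ to S hits 1, and the exchange rule μ(t) t' = μ(t') t then forces injectivity.
-/
lemma invertible_piece [Fact p.Prime] : Module.Invertible S (G.Piece 1) := by
  let N := Twist σ (G.Piece (-1))
  let un : N → G.Piece (-1) := fun n => n
  have un_smul : ∀ (s : S) (n : N), un (s • n) = σ.symm s • un n := fun _ _ => rfl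
  have un_add : ∀ (m n : N), un (m + n) = un m + un n := fun _ _ => rfl
  let β : G.Piece 1 →ₗ[S] N →ₗ[S] S := LinearMap.mk₂ S (fun j n => G.pairing j (un n))
    (fun j j' n => G.injective (by simp [add_mul]))
    (fun s j n => G.injective (by simp [incl_smul, mul_assoc]))
    (fun j n n' => G.injective (by simp [mul_add, un_add]))
    (fun s j n => G.injective (by
      simp [incl_smul, un_smul, ← mul_assoc, incl_mul_ι]))
  have hβ : ∀ j n, G.ι (β j n) = G.incl j * G.incl (un n) := fun j n => G.ι_pairing _ _
  let μ : G.Piece 1 ⊗[S] N →ₗ[S] S := TensorProduct.lift β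
  have hμ : ∀ j n, μ (j ⊗ₜ n) = β j n := fun j n => TensorProduct.lift.tmul _ _
  -- a tensor with product `1`
  have h1 : ∀ w ∈ G.part 1 * G.part (-1), ∃ ε : G.Piece 1 ⊗[S] N, G.ι (μ ε) = w := by
    intro w hw
    induction hw using Submodule.mul_induction_on' with
    | mem_mul_mem k' hk' m' hm' =>
      obtain ⟨j, rfl⟩ := G.exists_incl hk'
      obtain ⟨n, rfl⟩ := G.exists_incl hm'
      exact ⟨j ⊗ₜ Twist.mk σ n, by rw [hμ, hβ]; rfl⟩
    | add x _ y _ hx hy =>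
      obtain ⟨c, rfl⟩ := hx
      obtain ⟨d, rfl⟩ := hy
      exact ⟨c + d, by simp⟩
  obtain ⟨ε, hε⟩ := h1 1 G.one_mem
  have hε1 : μ ε = 1 := G.injective (by rw [hε, map_one])
  have swap : ∀ t t' : G.Piece 1 ⊗[S] N, μ t • t' = μ t' • t := by
    intro t t'
    induction t with
    | zero => simp
    | add x y hx hy => rw [map_add, add_smul, hx, hy, smul_add]
    | tmul j n =>
      induction t' with
      | zero => simp
      | add x y hx hy => rw [map_add, add_smul, ← hx, ← hy, smul_add]
      | tmul j' n' =>
        -- The two tensor factors are exchanged one at a time.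
        have e1 : β j n • j' = β j' n • j := G.dual_apply_smul (β.flip n) j j'
        have e2 : β j' n • n' = β j' n' • n := by
          obtain ⟨t, ht⟩ := G.mul_mem_zero (k := -1) (G.incl_mem (un n))
            (by simpa using G.incl_mem j')
          have h2 : G.pairing j' (un n) = σ t :=
            G.mul_eq_σ_mul (G.incl_mem j') (G.incl_mem (un n)) (G.ι_pairing _ _) ht
          apply (G.incl_injective : Function.Injective (G.incl (k := -1)))
          change G.incl (un (β j' n • n')) = G.incl (un (β j' n' • n))
          rw [un_smul, un_smul, incl_smul, incl_smul, ← G.comm_neg_one (G.incl_mem (un n)), hβ]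
          have : σ.symm (β j' n) = t := by
            rw [AlgEquiv.symm_apply_eq]
            exact h2
          rw [this, ht, mul_assoc]
        rw [hμ, hμ, TensorProduct.smul_tmul', e1, TensorProduct.smul_tmul, e2,
          ← TensorProduct.smul_tmul, ← TensorProduct.smul_tmul']
  refine Module.Invertible.left (N := N) (LinearEquiv.ofBijective μ ⟨?_, ?_⟩)
  · rw [injective_iff_map_eq_zero]
    intro t ht
    have := swap ε t
    rwa [hε1, ht, zero_smul, one_smul] at this
  · intro s
    exact ⟨s • ε, by rw [map_smul, hε1, smul_eq_mul, mul_one]⟩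

end Piece
end CyclicGrading

/-! ### The exchange rule for linear forms on tensor products -/

section Swap

variable {ι S : Type*} [Fintype ι] [DecidableEq ι] [CommRing S] {M : ι → Type*}
  [∀ i, AddCommGroup (M i)] [∀ i, Module S (M i)]

/-- If all linear forms `ψ` on the modules `M i` satisfy `ψ(m) n = ψ(n) m`, then so do those on
their tensor product. -/
lemma PiTensorProduct.dual_apply_smul
    (h : ∀ i (ψ : M i →ₗ[S] S) (m n : M i), ψ m • n = ψ n • m)
    (φ : PiTensorProduct S M →ₗ[S] S) (t t' : PiTensorProduct S M) : φ t • t' = φ t' • t := by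
  have pure : ∀ m n : ∀ i, M i, φ (tprod S m) • tprod S n = φ (tprod S n) • tprod S m := by
    intro m n
    -- Exchange the entries of m and n at the indices in T, one index at a time; T = `univ` is the
    -- claim.
    have key : ∀ T : Finset ι, φ (tprod S m) • tprod S n =
        φ (tprod S (T.piecewise n m)) • tprod S (T.piecewise m n) := by
      intro T
      induction T using Finset.induction_on with
      | empty => simp
      | insert i T hi ih =>
        rw [ih, Finset.piecewise_insert, Finset.piecewise_insert]
        let ψ : M i →ₗ[S] S := φ ∘ₗ (tprod S).toLinearMap (T.piecewise n m) i
        have hψ : ∀ v, φ (tprod S (Function.update (T.piecewise n m) i v)) = ψ v := fun _ => rfl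
        have e1 : φ (tprod S (T.piecewise n m)) = ψ (m i) := by
          rw [← hψ]; congr 2
          rw [eq_comm, Function.update_eq_self_iff]; simp [hi]
        have e2 : tprod S (T.piecewise m n) =
            tprod S (Function.update (T.piecewise m n) i (n i)) := by
          congr 1
          rw [eq_comm, Function.update_eq_self_iff]; simp [hi]
        rw [hψ, e1, e2, ← (tprod S).map_update_smul, h i ψ, (tprod S).map_update_smul]
    simpa using key Finset.univ
  induction t using PiTensorProduct.induction_on with
  | smul_tprod r m =>
    induction t' using PiTensorProduct.induction_on with
    | smul_tprod r' n =>
      rw [map_smul, map_smul, smul_smul, smul_smul, smul_eq_mul, smul_eq_mul, mul_right_comm,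
        mul_smul, pure m n, smul_smul]
      congr 1; ring
    | add x y hx hy => rw [map_add, add_smul, ← hx, ← hy, smul_add]
  | add x y hx hy => rw [map_add, add_smul, hx, hy, smul_add]

end Swap

/-! ### The isomorphism φ given by p-fold multiplication -/

namespace CyclicGrading

variable {R S A : Type*} [CommRing R] [CommRing S] [Algebra R S] [Ring A] [Algebra R A] {p : ℕ}
  {σ : S ≃ₐ[R] S} (G : CyclicGrading A p σ) [Fact p.Prime]

/-- Isolating the i-th factor leaves a prefix a of i factors of degree one, which passes scalars
through σ^i. This is exactly the linearity demanded by the twist σ^i(J). -/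
lemma exists_prod_update {n : ℕ} (m : Fin n → G.Piece 1) (i : Fin n) :
    ∃ a c : A, (∀ s, a * G.ι s = G.ι ((σ ^ (i : ℕ)) s) * a) ∧
      ∀ v, (List.ofFn fun k => G.incl (Function.update m i v k)).prod = a * G.incl v * c := by
  induction n with
  | zero => exact i.elim0
  | succ n ih =>
    induction i using Fin.cases with
    | zero =>
      refine ⟨1, (List.ofFn fun k : Fin n => G.incl (m k.succ)).prod, by simp, fun v => ?_⟩
      simp [List.ofFn_succ]
    | succ i =>
      obtain ⟨a, c, ha, hc⟩ := ih (fun k => m k.succ) i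
      refine ⟨G.incl (m 0) * a, c, fun s => ?_, fun v => ?_⟩
      · rw [mul_assoc, ha, ← mul_assoc, G.comm_one (G.incl_mem _), Fin.val_succ, pow_succ',
          mul_assoc]
        rfl
      · rw [List.ofFn_succ, List.prod_cons, Function.update_of_ne (Fin.succ_ne_zero i).symm,
          mul_assoc, mul_assoc, ← mul_assoc a, ← hc]
        congr 3
        ext k
        congr 1
        by_cases hk : k = i
        · subst hk; simp
        · rw [Function.update_of_ne hk, Function.update_of_ne (by simpa using hk)]

lemma prod_ofFn_mem {n : ℕ} (m : Fin n → G.Piece 1) :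
    (List.ofFn fun k => G.incl (m k)).prod ∈ G.part (n : ZMod p) := by
  induction n with
  | zero => simpa using G.ι_mem 1
  | succ n ih =>
    rw [List.ofFn_succ, List.prod_cons, Nat.cast_succ, add_comm]
    exact G.mul_mem (G.incl_mem _) (ih fun k => m k.succ)

/-- The product of `p` elements of degree one, as an element of `S`. -/
noncomputable def cyclicProd (m : Fin p → G.Piece 1) : S :=
  ((G.mem_zero _).1 (by simpa using G.prod_ofFn_mem m)).choose

lemma ι_cyclicProd (m : Fin p → G.Piece 1) :
    G.ι (G.cyclicProd m) = (List.ofFn fun k => G.incl (m k)).prod :=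
  ((G.mem_zero _).1 (by simpa using G.prod_ofFn_mem m)).choose_spec

lemma cyclicProd_update_add (m : Fin p → G.Piece 1) (i : Fin p) (v w : G.Piece 1) :
    G.cyclicProd (Function.update m i (v + w)) =
      G.cyclicProd (Function.update m i v) + G.cyclicProd (Function.update m i w) := by
  obtain ⟨a, c, -, hc⟩ := G.exists_prod_update m i
  apply G.injective
  rw [map_add, ι_cyclicProd, ι_cyclicProd, ι_cyclicProd, hc, hc, hc, map_add, mul_add, add_mul]

lemma cyclicProd_update_smul (m : Fin p → G.Piece 1) (i : Fin p) (s : S) (v : G.Piece 1) :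
    G.cyclicProd (Function.update m i ((σ ^ (i : ℕ)).symm s • v)) =
      s * G.cyclicProd (Function.update m i v) := by
  obtain ⟨a, c, ha, hc⟩ := G.exists_prod_update m i
  apply G.injective
  rw [map_mul, ι_cyclicProd, ι_cyclicProd, hc, hc, incl_smul, ← mul_assoc, ha,
    AlgEquiv.apply_symm_apply]
  simp only [mul_assoc]

/-- The product map as a multilinear map on the twists of the part of degree one. -/
noncomputable def cyclicProdMultilinear :
    MultilinearMap S (fun i : Fin p => Twist (σ ^ (i : ℕ)) (G.Piece 1)) S :=
  MultilinearMap.mk' (fun m => G.cyclicProd m)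
    (fun m i v w => G.cyclicProd_update_add m i v w)
    (fun m i s v => G.cyclicProd_update_smul m i s v)

/-- The product map `J ⊗ σ(J) ⊗ ⋯ ⊗ σ ^ (p - 1) (J) → S`. -/
noncomputable def normMap : TwistPow σ p (G.Piece 1) →ₗ[S] S :=
  PiTensorProduct.lift G.cyclicProdMultilinear

lemma normMap_mk (m : Fin p → G.Piece 1) : G.normMap (TwistPow.mk σ m) = G.cyclicProd m :=
  PiTensorProduct.lift.tprod _

lemma exists_normMap_eq_one : ∃ ε, G.normMap ε = 1 := by
  obtain ⟨n, hn⟩ := Nat.exists_eq_succ_of_ne_zero (Fact.out : p.Prime).ne_zero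
  -- The part of degree zero is also the part of degree p, which lies in A₁^p.
  have h1 : (1 : A) ∈ G.part 1 ^ p := by
    have h := G.part_natCast_le_pow n
    rw [← Nat.succ_eq_add_one, ← hn, ZMod.natCast_self] at h
    refine h ?_
    simpa using G.ι_mem 1
  have h2 : ∀ w ∈ G.part 1 ^ p, ∃ ε, G.ι (G.normMap ε) = w := by
    intro w hw
    rw [← Submodule.span_eq (G.part 1), Submodule.span_pow] at hw
    induction hw using Submodule.span_induction with
    | mem x hx =>
      obtain ⟨f, rfl⟩ := Set.mem_pow.1 hx
      let g : Fin p → G.Piece 1 := f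
      exact ⟨TwistPow.mk σ g, by rw [normMap_mk, ι_cyclicProd]; rfl⟩
    | zero => exact ⟨0, by simp⟩
    | add x y _ _ hx hy =>
      obtain ⟨e, rfl⟩ := hx
      obtain ⟨e', rfl⟩ := hy
      exact ⟨e + e', by simp⟩
    | smul r x _ hx =>
      obtain ⟨e, rfl⟩ := hx
      exact ⟨algebraMap R S r • e, by simp [Algebra.smul_def]⟩
  obtain ⟨ε, hε⟩ := h2 1 h1
  exact ⟨ε, G.injective (by rw [hε, map_one])⟩

/-- Composing with τ⁻¹ turns a form on the twist into a form on A₁ itself. -/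
lemma twist_dual_apply_smul (τ : S ≃ₐ[R] S) (ψ : Twist τ (G.Piece 1) →ₗ[S] S)
    (j k : Twist τ (G.Piece 1)) : ψ j • k = ψ k • j := by
  let ψ' : G.Piece 1 →ₗ[S] S :=
    { toFun := fun j => τ.symm (ψ (Twist.mk τ j))
      map_add' := fun j k => by
        rw [← map_add, ← map_add]; rfl
      map_smul' := fun s j => by
        have : Twist.mk τ (s • j) = τ s • Twist.mk τ j := by
          change s • j = (τ.symm (τ s)) • j
          rw [AlgEquiv.symm_apply_apply]
        rw [this, map_smul, smul_eq_mul, map_mul, AlgEquiv.symm_apply_apply]; rfl }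
  exact G.dual_apply_smul ψ' j k

/-- If ε maps to 1 and t to 0, the exchange rule gives t = N(ε) t = N(t) ε = 0, N being the product
map. -/
lemma normMap_bijective : Function.Bijective G.normMap := by
  obtain ⟨ε, hε⟩ := G.exists_normMap_eq_one
  constructor
  · rw [injective_iff_map_eq_zero]
    intro t ht
    have := PiTensorProduct.dual_apply_smul (fun i : Fin p => G.twist_dual_apply_smul (σ ^ (i : ℕ)))
      G.normMap ε t
    rwa [hε, ht, zero_smul, one_smul] at this
  · intro s
    exact ⟨s • ε, by rw [map_smul, hε, smul_eq_mul, mul_one]⟩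

/-- The product map is an isomorphism `J ⊗ σ(J) ⊗ ⋯ ⊗ σ ^ (p - 1) (J) ≅ S`. -/
noncomputable def normEquiv : TwistPow σ p (G.Piece 1) ≃ₗ[S] S :=
  LinearEquiv.ofBijective G.normMap G.normMap_bijective

lemma ι_normEquiv_mk (m : Fin p → G.Piece 1) :
    G.ι (G.normEquiv (TwistPow.mk σ m)) = (List.ofFn fun k => G.incl (m k)).prod := by
  rw [← ι_cyclicProd, ← normMap_mk]; rfl

/-- The rotation moves the last factor, of degree 1, in front of the other p - 1, whose product has
degree -1. So this is an instance of km = σ(mk). -/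
lemma preservesAction_normEquiv : PreservesAction G.normEquiv := by
  intro m
  obtain ⟨n, rfl⟩ := Nat.exists_eq_succ_of_ne_zero (Fact.out : p.Prime).ne_zero
  have hn : ((n : ℕ) : ZMod (n + 1)) = -1 := by
    rw [eq_neg_iff_add_eq_zero, ← Nat.cast_succ]
    exact ZMod.natCast_self _
  refine G.mul_eq_σ_mul (k := G.incl (m (Fin.last n)))
    (m := (List.ofFn fun k : Fin n => G.incl (m k.castSucc)).prod) (G.incl_mem _)
    (hn ▸ G.prod_ofFn_mem _) ?_ ?_
  · rw [ι_normEquiv_mk, List.ofFn_succ, List.prod_cons]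
    have h0 : (finRotate (n + 1)).symm 0 = Fin.last n := by
      rw [Equiv.symm_apply_eq, finRotate_last]
    have hs : ∀ k : Fin n, (finRotate (n + 1)).symm k.succ = k.castSucc := fun k => by
      rw [Equiv.symm_apply_eq, finRotate_apply, Fin.coeSucc_eq_succ]
    simp only [Nat.succ_eq_add_one, h0, hs]
  · rw [ι_normEquiv_mk, List.ofFn_succ', List.concat_eq_append, List.prod_append,
      List.prod_singleton]
end CyclicGrading

/-! ### Spanning the algebra Δ by powers of Jt -/

namespace Delta

variable {R S J : Type*} [CommRing R] [CommRing S] [Algebra R S] [AddCommGroup J] [Module S J]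
  (σ : S ≃ₐ[R] S) {n : ℕ} (φ : TwistPow σ n J ≃ₗ[S] S)

/-- The canonical map `J → Δ(S/R, σ, J, φ)`. -/
noncomputable def ofModule (j : J) : Delta σ φ :=
  RingQuot.mkAlgHom R (DeltaRel σ φ) (FreeAlgebra.ι R (Sum.inr j))

lemma mkAlgHom_eq {x y : FreeAlgebra R (S ⊕ J)} (h : DeltaRel σ φ x y) :
    RingQuot.mkAlgHom R (DeltaRel σ φ) x = RingQuot.mkAlgHom R (DeltaRel σ φ) y :=
  RingQuot.mkAlgHom_rel R h

lemma ofBase_algebraMap (r : R) : ofBase σ φ (algebraMap R S r) = algebraMap R _ r := by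
  simpa [ofBase, ofModule] using mkAlgHom_eq σ φ (.base_algebraMap r)

lemma ofBase_add (s t : S) : ofBase σ φ (s + t) = ofBase σ φ s + ofBase σ φ t := by
  simpa [ofBase, ofModule] using mkAlgHom_eq σ φ (.base_add s t)

lemma ofBase_mul (s t : S) : ofBase σ φ (s * t) = ofBase σ φ s * ofBase σ φ t := by
  simpa [ofBase, ofModule] using mkAlgHom_eq σ φ (.base_mul s t)

lemma ofBase_mul_ofModule (s : S) (j : J) :
    ofBase σ φ s * ofModule σ φ j = ofModule σ φ (s • j) := by
  simpa [ofBase, ofModule] using mkAlgHom_eq σ φ (.left_smul s j)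

lemma ofModule_mul_ofBase (s : S) (j : J) :
    ofModule σ φ j * ofBase σ φ s = ofModule σ φ (σ s • j) := by
  simpa [ofBase, ofModule] using mkAlgHom_eq σ φ (.right_smul s j)

lemma prod_ofModule (j : Fin n → J) :
    (List.ofFn fun i => ofModule σ φ (j i)).prod = ofBase σ φ (φ (TwistPow.mk σ j)) := by
  have := mkAlgHom_eq σ φ (.norm j)
  rw [map_list_prod, List.map_ofFn] at this
  exact this

/-- The canonical map `S → Δ(S/R, σ, J, φ)` as a homomorphism of algebras. -/
noncomputable def baseHom : S →ₐ[R] Delta σ φ where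
  toFun := ofBase σ φ
  map_one' := by simpa using ofBase_algebraMap σ φ 1
  map_mul' := ofBase_mul σ φ
  map_zero' := by simpa using ofBase_algebraMap σ φ 0
  map_add' := ofBase_add σ φ
  commutes' := ofBase_algebraMap σ φ

/-- The image `J t` of `J` in `Δ(S/R, σ, J, φ)`. -/
noncomputable def modulePart : Submodule R (Delta σ φ) := Submodule.span R (Set.range (ofModule σ φ))

/-- The image of `S` in `Δ(S/R, σ, J, φ)`. -/
noncomputable def basePart : Submodule R (Delta σ φ) := LinearMap.range (baseHom σ φ).toLinearMap

lemma ofModule_mem (j : J) : ofModule σ φ j ∈ modulePart σ φ := Submodule.subset_span ⟨j, rfl⟩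

lemma ofBase_mem (s : S) : ofBase σ φ s ∈ basePart σ φ := ⟨s, rfl⟩

lemma basePart_mul_modulePart : basePart σ φ * modulePart σ φ ≤ modulePart σ φ := by
  have : basePart σ φ = Submodule.span R (Set.range (ofBase σ φ)) := by
    rw [basePart, ← Submodule.span_eq (LinearMap.range _)]; rfl
  rw [this, modulePart, Submodule.span_mul_span, Submodule.span_le]
  rintro _ ⟨_, ⟨s, rfl⟩, _, ⟨j, rfl⟩, rfl⟩
  change ofBase σ φ s * ofModule σ φ j ∈ modulePart σ φ
  exact (ofBase_mul_ofModule σ φ s j) ▸ ofModule_mem σ φ _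

lemma modulePart_mul_basePart : modulePart σ φ * basePart σ φ ≤ modulePart σ φ := by
  have : basePart σ φ = Submodule.span R (Set.range (ofBase σ φ)) := by
    rw [basePart, ← Submodule.span_eq (LinearMap.range _)]; rfl
  rw [this, modulePart, Submodule.span_mul_span, Submodule.span_le]
  rintro _ ⟨_, ⟨j, rfl⟩, _, ⟨s, rfl⟩, rfl⟩
  change ofModule σ φ j * ofBase σ φ s ∈ modulePart σ φ
  exact (ofModule_mul_ofBase σ φ s j) ▸ ofModule_mem σ φ _

lemma basePart_mul_pow (k : ℕ) : basePart σ φ * modulePart σ φ ^ (k + 1) ≤ modulePart σ φ ^ (k + 1) := by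
  rw [pow_succ', ← mul_assoc]
  exact mul_le_mul' (basePart_mul_modulePart σ φ) le_rfl

/-- One inclusion is the norm relation, the other is surjectivity of φ. -/
lemma modulePart_pow [NeZero n] : modulePart σ φ ^ n = basePart σ φ := by
  apply le_antisymm
  · rw [modulePart, Submodule.span_pow, Submodule.span_le]
    intro x hx
    obtain ⟨f, rfl⟩ := Set.mem_pow.1 hx
    choose j hj using fun i => (f i).2
    simp_rw [← hj]
    rw [prod_ofModule]
    exact ofBase_mem σ φ _
  · rintro _ ⟨s, rfl⟩
    obtain ⟨t, rfl⟩ := φ.surjective s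
    change ofBase σ φ (φ t) ∈ _
    induction t using PiTensorProduct.induction_on with
    | smul_tprod r m =>
      rw [map_smul, smul_eq_mul, ofBase_mul]
      obtain ⟨k, hk⟩ := Nat.exists_eq_succ_of_ne_zero (NeZero.ne n)
      have h := basePart_mul_pow σ φ k
      rw [← Nat.succ_eq_add_one, ← hk] at h
      refine h (Submodule.mul_mem_mul (ofBase_mem σ φ r) ?_)
      let m' : Fin n → J := m
      change ofBase σ φ (φ (TwistPow.mk σ m')) ∈ _
      rw [← prod_ofModule]
      exact Submodule.pow_subset_pow _ (Set.mem_pow.2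
        ⟨fun i => ⟨_, ofModule_mem σ φ (m' i)⟩, rfl⟩)
    | add x y hx hy => rw [map_add, ofBase_add]; exact add_mem hx hy

/-- The exponents run over 1, …, n, not 0, …, n - 1: the zeroth power is only the image of R,
whereas S is the n-th power. The sum contains 1 and is stable under left multiplication by
generators. -/
lemma iSup_pow [NeZero n] : ⨆ k : Fin n, modulePart σ φ ^ ((k : ℕ) + 1) = ⊤ := by
  obtain ⟨m, rfl⟩ := Nat.exists_eq_succ_of_ne_zero (NeZero.ne n)
  set W := ⨆ k : Fin (m + 1), modulePart σ φ ^ ((k : ℕ) + 1) with hW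
  have hB : basePart σ φ ≤ W := by
    rw [← modulePart_pow]
    exact le_iSup (fun k : Fin (m + 1) => modulePart σ φ ^ ((k : ℕ) + 1)) (Fin.last m)
  have hBW : basePart σ φ * W ≤ W := by
    rw [hW, Submodule.mul_iSup]
    exact iSup_mono fun k => basePart_mul_pow σ φ k
  have hNW : modulePart σ φ * W ≤ W := by
    rw [hW, Submodule.mul_iSup]
    refine iSup_le fun k => ?_
    rw [← pow_succ']
    induction k using Fin.lastCases with
    | last =>
      -- Exponent n + 1 wraps around to 1, because (Jt)^n = S and Jt · S ⊆ Jt.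
      have : modulePart σ φ ^ ((Fin.last m : Fin (m + 1)).val + 1 + 1) ≤ modulePart σ φ ^ (0 + 1) := by
        rw [pow_succ', Fin.val_last, zero_add, pow_one]
        exact (mul_le_mul' le_rfl (modulePart_pow σ φ).le).trans (modulePart_mul_basePart σ φ)
      exact this.trans (le_iSup (fun k : Fin (m + 1) => modulePart σ φ ^ ((k : ℕ) + 1)) 0)
    | cast k => exact le_iSup (fun k : Fin (m + 1) => modulePart σ φ ^ ((k : ℕ) + 1)) k.succ
  have stab : ∀ x : FreeAlgebra R (S ⊕ J), ∀ w ∈ W,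
      RingQuot.mkAlgHom R (DeltaRel σ φ) x * w ∈ W := by
    intro x
    induction x using FreeAlgebra.induction with
    | grade0 r =>
      intro w hw
      rw [AlgHom.commutes, ← Algebra.smul_def]
      exact W.smul_mem r hw
    | grade1 x =>
      intro w hw
      rcases x with s | j
      · exact hBW (Submodule.mul_mem_mul (ofBase_mem σ φ s) hw)
      · exact hNW (Submodule.mul_mem_mul (ofModule_mem σ φ j) hw)
    | mul x y hx hy =>
      intro w hw
      rw [map_mul, mul_assoc]
      exact hx _ (hy _ hw)
    | add x y hx hy =>
      intro w hw
      rw [map_add, add_mul]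
      exact add_mem (hx _ hw) (hy _ hw)
  rw [eq_top_iff]
  intro x _
  obtain ⟨x, rfl⟩ := RingQuot.mkAlgHom_surjective R (DeltaRel σ φ) x
  simpa using stab x 1 (hB ⟨1, map_one (baseHom σ φ)⟩)

end Delta

/-! ### The isomorphism of Δ with a graded algebra -/

namespace CyclicGrading

variable {R S A : Type*} [CommRing R] [CommRing S] [Algebra R S] [Ring A] [Algebra R A] {p : ℕ}
  {σ : S ≃ₐ[R] S} (G : CyclicGrading A p σ) [Fact p.Prime]

/-- The canonical map from `Δ` to an algebra with a cyclic grading. -/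
noncomputable def ofDelta : Delta σ G.normEquiv →ₐ[R] A :=
  RingQuot.liftAlgHom R ⟨FreeAlgebra.lift R (Sum.elim G.ι G.incl), by
    intro x y h
    induction h with
    | base_algebraMap r => simp
    | base_add s s' => simp
    | base_mul s s' => simp
    | mod_add j j' => simp
    | left_smul s j => simp [incl_smul]
    | right_smul s j => simp [incl_mul_ι]
    | norm j =>
      rw [map_list_prod, List.map_ofFn]
      simp only [FreeAlgebra.lift_ι_apply, Sum.elim_inl, ι_normEquiv_mk]
      congr 2
      ext i
      simp⟩

@[simp]
lemma ofDelta_ofBase (s : S) : G.ofDelta (Delta.ofBase σ G.normEquiv s) = G.ι s := by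
  simp [ofDelta, Delta.ofBase]

@[simp]
lemma ofDelta_ofModule (j : G.Piece 1) :
    G.ofDelta (Delta.ofModule σ G.normEquiv j) = G.incl j := by
  simp [ofDelta, Delta.ofModule]

lemma ofDelta_surjective : Function.Surjective G.ofDelta := by
  have h1 : G.part 1 ≤ Subalgebra.toSubmodule G.ofDelta.range := fun v hv => by
    obtain ⟨j, rfl⟩ := G.exists_incl hv
    exact ⟨_, G.ofDelta_ofModule j⟩
  have h : ∀ n : ℕ, G.part (n : ZMod p) ≤ Subalgebra.toSubmodule G.ofDelta.range := by
    intro n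
    induction n with
    | zero =>
      intro v hv
      rw [Nat.cast_zero, mem_zero] at hv
      obtain ⟨s, rfl⟩ := hv
      exact ⟨_, G.ofDelta_ofBase s⟩
    | succ n ih =>
      rw [Nat.cast_succ]
      refine (G.part_add_one_le _).trans (Submodule.mul_le.2 fun v hv w hw => ?_)
      exact G.ofDelta.range.mul_mem (ih hv) (h1 hw)
  have : (⊤ : Submodule R A) ≤ Subalgebra.toSubmodule G.ofDelta.range := by
    rw [← G.iSup_part]
    exact iSup_le fun k => by simpa using h k.val
  exact fun v => this (Submodule.mem_top (x := v))

lemma ofDelta_pow_mem {m : ℕ} {d : Delta σ G.normEquiv}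
    (hd : d ∈ Delta.modulePart σ G.normEquiv ^ m) : G.ofDelta d ∈ G.part (m : ZMod p) := by
  have h : (Delta.modulePart σ G.normEquiv).map G.ofDelta.toLinearMap ≤ G.part 1 := by
    rw [Delta.modulePart, Submodule.map_span, Submodule.span_le]
    rintro _ ⟨_, ⟨j, rfl⟩, rfl⟩
    simpa using G.incl_mem j
  refine G.pow_le_part m (pow_le_pow_left' h m ?_)
  rw [← Submodule.map_pow]
  exact ⟨d, hd, rfl⟩

/-- Multiplying d by (Jt)^(p-m) lands in the image of S, where injectivity is known. As (Jt)^(p-m)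
(Jt)^m = S contains 1, d itself vanishes. -/
lemma eq_zero_of_ofDelta_eq_zero {m : ℕ} (hm : m ≤ p) {d : Delta σ G.normEquiv}
    (hd : d ∈ Delta.modulePart σ G.normEquiv ^ m) (h : G.ofDelta d = 0) : d = 0 := by
  have hp : Delta.modulePart σ G.normEquiv ^ p = Delta.basePart σ G.normEquiv :=
    Delta.modulePart_pow σ G.normEquiv
  have h1 : ∀ e ∈ Delta.modulePart σ G.normEquiv ^ (p - m), d * e = 0 := by
    intro e he
    have hde := Submodule.mul_mem_mul hd he
    rw [← pow_add, Nat.add_sub_cancel' hm, hp] at hde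
    obtain ⟨s, hs⟩ := hde
    have hs' : Delta.ofBase σ G.normEquiv s = d * e := hs
    have : G.ι s = 0 := by rw [← ofDelta_ofBase, hs', map_mul, h, zero_mul]
    rw [← hs', G.injective (this.trans (map_zero _).symm)]
    exact map_zero (Delta.baseHom σ G.normEquiv)
  have h2 : ∀ w ∈ Delta.modulePart σ G.normEquiv ^ (p - m) * Delta.modulePart σ G.normEquiv ^ m,
      d * w = 0 := by
    intro w hw
    induction hw using Submodule.mul_induction_on' with
    | mem_mul_mem e he f hf => rw [← mul_assoc, h1 e he, zero_mul]
    | add x _ y _ hx hy => rw [mul_add, hx, hy, add_zero]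
  have h3 := h2 1 (by
    rw [← pow_add, Nat.sub_add_cancel hm, hp]
    exact ⟨1, map_one (Delta.baseHom σ G.normEquiv)⟩)
  rwa [mul_one] at h3

lemma ofDelta_injective : Function.Injective G.ofDelta := by
  rw [injective_iff_map_eq_zero]
  intro d hd
  have hmem : d ∈ ⨆ k : Fin p, Delta.modulePart σ G.normEquiv ^ ((k : ℕ) + 1) := by
    rw [Delta.iSup_pow]; trivial
  rw [Submodule.mem_iSup_iff_exists_finsupp] at hmem
  obtain ⟨f, hf, hsum⟩ := hmem
  rw [Finsupp.sum_fintype _ _ (fun _ => rfl)] at hsum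
  -- The exponents 1, …, p represent each degree exactly once, so independence of the grading
  -- separates the summands.
  let e : Fin p ≃ ZMod p := Equiv.ofBijective (fun k : Fin p => (((k : ℕ) + 1 : ℕ) : ZMod p)) <| by
    rw [Fintype.bijective_iff_injective_and_card]
    refine ⟨fun k l hkl => Fin.ext ?_, by simp [ZMod.card]⟩
    have := Nat.ModEq.add_right_cancel' 1 ((ZMod.natCast_eq_natCast_iff _ _ _).1 hkl)
    exact this.eq_of_lt_of_lt k.2 l.2
  have he : ∀ k : Fin p, e k = (((k : ℕ) + 1 : ℕ) : ZMod p) := fun _ => rfl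
  have h0 := G.indep (fun k => G.ofDelta (f (e.symm k)))
    (fun k => by
      have := G.ofDelta_pow_mem (hf (e.symm k))
      rwa [← he, Equiv.apply_symm_apply] at this) (by
      rw [finsum_eq_sum_of_fintype, Equiv.sum_comp e.symm (fun k => G.ofDelta (f k)), ← map_sum,
        hsum, hd])
  rw [← hsum]
  refine Finset.sum_eq_zero fun k _ => ?_
  refine G.eq_zero_of_ofDelta_eq_zero (m := k + 1) k.2 (hf k) ?_
  simpa using h0 (e k)

theorem isAlmostCyclic {R S A : Type u} [CommRing R] [CommRing S] [Algebra R S] [Ring A]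
    [Algebra R A] {p : ℕ} [Fact p.Prime] {σ : S ≃ₐ[R] S} (G : CyclicGrading A p σ)
    (hσ : IsCyclicGalois R S p σ) : IsAlmostCyclic R p G.ι.range :=
  ⟨S, inferInstance, inferInstance, AlgEquiv.ofInjective G.ι G.injective, σ, G.Piece 1,
    inferInstance, inferInstance, G.normEquiv, hσ, G.invertible_piece, G.preservesAction_normEquiv,
    AlgEquiv.ofBijective G.ofDelta ⟨G.ofDelta_injective, G.ofDelta_surjective⟩,
    fun s => G.ofDelta_ofBase s⟩

end CyclicGrading

/-! ### The Azumaya property of a strongly graded algebra -/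

lemma bijective_mulLeftRight_of_surjective {R A κ : Type*} [CommRing R] [Ring A] [Algebra R A]
    [Finite κ] (b : Module.Basis κ R A) (h : Function.Surjective (AlgHom.mulLeftRight R A)) :
    Function.Bijective (AlgHom.mulLeftRight R A) := by
  classical
  have := Fintype.ofFinite κ
  have : Module.Finite R A := .of_basis b
  have : Module.Free R A := .of_basis b
  let e : A ⊗[R] Aᵐᵒᵖ ≃ₗ[R] Module.End R A :=
    (b.tensorProduct (b.map (MulOpposite.opLinearEquiv R))).equiv (b.linearMap b) (Equiv.refl _)
  -- Source and target are free of the same finite rank, so a surjection between them is injective.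
  exact OrzechProperty.bijective_of_surjective_of_injective e.toLinearMap
    (AlgHom.mulLeftRight R A).toLinearMap e.injective h

lemma mulLeft_mem_range {R A : Type*} [CommRing R] [Ring A] [Algebra R A] (a : A) :
    LinearMap.mulLeft R a ∈ (AlgHom.mulLeftRight R A).range :=
  ⟨a ⊗ₜ 1, by ext; simp⟩

lemma mulRight_mem_range {R A : Type*} [CommRing R] [Ring A] [Algebra R A] (a : A) :
    LinearMap.mulRight R a ∈ (AlgHom.mulLeftRight R A).range :=
  ⟨1 ⊗ₜ MulOpposite.op a, by ext; simp⟩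

namespace CyclicGrading

variable {R S A : Type*} [CommRing R] [CommRing S] [Algebra R S] [Ring A] [Algebra R A] {p : ℕ}
  {σ : S ≃ₐ[R] S} (G : CyclicGrading A p σ)

include G

lemma linearMap_ext {M : Type*} [AddCommGroup M] [Module R M] {f g : A →ₗ[R] M}
    (h : ∀ k, ∀ v ∈ G.part k, f v = g v) : f = g := by
  have : (⊤ : Submodule R A) ≤ LinearMap.eqLocus f g := by
    rw [← G.iSup_part]
    exact iSup_le h
  ext v
  exact this (Submodule.mem_top (x := v))

variable [Fact p.Prime]

/-- The projection to the part of degree zero is a combination of left and right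
multiplications. -/
lemma exists_projection (x y : Fin p → S)
    (hxy : ∀ k : ZMod p, ∑ i, x i * (σ ^ k.val) (y i) = if k = 0 then 1 else 0) :
    ∃ π ∈ (AlgHom.mulLeftRight R A).range, ∀ k, ∀ v ∈ G.part k, π v = if k = 0 then v else 0 := by
  refine ⟨∑ i, LinearMap.mulLeft R (G.ι (x i)) * LinearMap.mulRight R (G.ι (y i)),
    sum_mem fun i _ => Subalgebra.mul_mem _ (mulLeft_mem_range _) (mulRight_mem_range _), fun k v hv => ?_⟩
  have : G.ι (∑ i, x i * (σ ^ k.val) (y i)) * v = if k = 0 then v else 0 := by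
    rw [hxy]; split_ifs <;> simp
  rw [← this, map_sum, Finset.sum_mul, LinearMap.sum_apply]
  refine Finset.sum_congr rfl fun i _ => ?_
  simp [Module.End.mul_apply, G.comm hv, mul_assoc]

/-- On the part of degree zero, the powers of `σ` are combinations of left and right
multiplications. -/
lemma exists_conj (k : ZMod p) :
    ∃ τ ∈ (AlgHom.mulLeftRight R A).range, ∀ s, τ (G.ι s) = G.ι ((σ ^ k.val) s) := by
  have : ∀ w ∈ G.part k * G.part (-k), ∃ τ ∈ (AlgHom.mulLeftRight R A).range,
      ∀ s, τ (G.ι s) = G.ι ((σ ^ k.val) s) * w := by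
    intro w hw
    induction hw using Submodule.mul_induction_on' with
    | mem_mul_mem m hm n hn =>
      refine ⟨LinearMap.mulLeft R m * LinearMap.mulRight R n,
        Subalgebra.mul_mem _ (mulLeft_mem_range _) (mulRight_mem_range _), fun s => ?_⟩
      simp [Module.End.mul_apply, ← mul_assoc, G.comm hm]
    | add x _ y _ hx hy =>
      obtain ⟨τ, hτ, h⟩ := hx
      obtain ⟨τ', hτ', h'⟩ := hy
      exact ⟨τ + τ', add_mem hτ hτ', fun s => by rw [LinearMap.add_apply, h, h', mul_add]⟩
  simpa using this 1 (G.one_mem_mul_neg k)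

/-- Let π project to S. The Galois condition puts π End(A) π in the image, and strongness writes 1
as a sum of operators L_m π L_n with L left multiplication. Hence every f = 1 · f · 1 is in the
image. -/
lemma mulLeftRight_surjective (hσ : IsCyclicGalois R S p σ) (x y : Fin p → S)
    (hxy : ∀ k : ZMod p, ∑ i, x i * (σ ^ k.val) (y i) = if k = 0 then 1 else 0) :
    Function.Surjective (AlgHom.mulLeftRight R A) := by
  obtain ⟨π, hπ, hπv⟩ := G.exists_projection x y hxy
  choose τ hτ hτs using G.exists_conj
  have hπ0 : ∀ v, π v ∈ G.part 0 := by
    have : (⊤ : Submodule R A) ≤ (G.part 0).comap π := by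
      rw [← G.iSup_part]
      refine iSup_le fun k v hv => ?_
      rw [Submodule.mem_comap, hπv k v hv]
      split_ifs with h
      · exact h ▸ hv
      · exact zero_mem _
    exact fun v => this (Submodule.mem_top (x := v))
  -- Such an operator is an R-endomorphism of S, hence of the form ∑ c_i σ^i; each σ^i is realized
  -- on S by `τ`.
  have hcorner : ∀ g : Module.End R A, π * g * π ∈ (AlgHom.mulLeftRight R A).range := by
    intro g
    choose h hh using fun s => (G.mem_zero _).1 (hπ0 (g (G.ι s)))
    let h' : Module.End R S :=
      { toFun := h
        map_add' := fun s t => G.injective (by simp [hh])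
        map_smul' := fun r s => G.injective (by simp [hh]) }
    obtain ⟨c, hc⟩ := hσ.bijective.2 h'
    have hc' : ∀ s, h s = ∑ i : Fin p, c i * (σ ^ (i : ℕ)) s := fun s => by
      have := (LinearMap.congr_fun hc s).symm
      simpa [h'] using this
    have : π * g * π =
        (∑ i : Fin p, LinearMap.mulLeft R (G.ι (c i)) * τ ((i : ℕ) : ZMod p)) * π := by
      refine G.linearMap_ext fun k v hv => ?_
      rw [Module.End.mul_apply, Module.End.mul_apply, Module.End.mul_apply, hπv k v hv]
      split_ifs with hk
      · subst hk
        obtain ⟨s, rfl⟩ := (G.mem_zero _).1 hv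
        rw [← hh, hc', map_sum, LinearMap.sum_apply]
        refine Finset.sum_congr rfl fun i _ => ?_
        rw [Module.End.mul_apply, hτs, ZMod.val_cast_of_lt i.2]
        simp
      · simp
    rw [this]
    exact Subalgebra.mul_mem _ (sum_mem fun i _ => Subalgebra.mul_mem _ (mulLeft_mem_range _) (hτ _)) hπ
  set Q : Submodule R (Module.End R A) := Submodule.span R
    {e | ∃ m n : A, e = LinearMap.mulLeft R m * π * LinearMap.mulLeft R n} with hQ
  -- With n of degree -k, L_m π L_n kills every degree but k, where it is multiplication by mn; sums
  -- of such mn give 1.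
  have hQk : ∀ k, ∃ e ∈ Q, ∀ l, ∀ v ∈ G.part l, e v = if l = k then v else 0 := by
    intro k
    have : ∀ w ∈ G.part k * G.part (-k), ∃ e ∈ Q, ∀ l, ∀ v ∈ G.part l,
        e v = if l = k then w * v else 0 := by
      intro w hw
      induction hw using Submodule.mul_induction_on' with
      | mem_mul_mem m hm n hn =>
        refine ⟨_, Submodule.subset_span ⟨m, n, rfl⟩, fun l v hv => ?_⟩
        rw [Module.End.mul_apply, Module.End.mul_apply, LinearMap.mulLeft_apply,
          LinearMap.mulLeft_apply, hπv _ _ (G.mul_mem hn hv)]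
        by_cases h : k = l
        · rw [if_pos (neg_add_eq_zero.2 h), if_pos h.symm, mul_assoc]
        · rw [if_neg (mt neg_add_eq_zero.1 h), if_neg (Ne.symm h), mul_zero]
      | add x _ y _ hx hy =>
        obtain ⟨e, he, h⟩ := hx
        obtain ⟨e', he', h'⟩ := hy
        refine ⟨e + e', add_mem he he', fun l v hv => ?_⟩
        rw [LinearMap.add_apply, h l v hv, h' l v hv]
        split_ifs <;> simp [add_mul]
    simpa using this 1 (G.one_mem_mul_neg k)
  choose e heQ he using hQk
  have h1 : (1 : Module.End R A) ∈ Q := by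
    have : (1 : Module.End R A) = ∑ k, e k := G.linearMap_ext fun l v hv => by
      simp [LinearMap.sum_apply, he _ l v hv]
    rw [this]
    exact sum_mem fun k _ => heQ k
  have hff : ∀ f : Module.End R A, ∀ q ∈ Q, ∀ q' ∈ Q,
      q * f * q' ∈ Subalgebra.toSubmodule (AlgHom.mulLeftRight R A).range := by
    intro f q hq q' hq'
    induction hq using Submodule.span_induction with
    | mem q hq =>
      obtain ⟨m, n, rfl⟩ := hq
      induction hq' using Submodule.span_induction with
      | mem q' hq' =>
        obtain ⟨m', n', rfl⟩ := hq'
        have : LinearMap.mulLeft R m * π * LinearMap.mulLeft R n * f *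
            (LinearMap.mulLeft R m' * π * LinearMap.mulLeft R n') = LinearMap.mulLeft R m *
            (π * (LinearMap.mulLeft R n * f * LinearMap.mulLeft R m') * π) *
            LinearMap.mulLeft R n' := by
          simp only [mul_assoc]
        rw [this]
        exact Subalgebra.mul_mem _ (Subalgebra.mul_mem _ (mulLeft_mem_range m) (hcorner _)) (mulLeft_mem_range n')
      | zero => rw [mul_zero]; exact zero_mem _
      | add _ _ _ _ hx hy => rw [mul_add]; exact add_mem hx hy
      | smul r _ _ hx => rw [mul_smul_comm]; exact Submodule.smul_mem _ r hx
    | zero => rw [zero_mul, zero_mul]; exact zero_mem _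
    | add _ _ _ _ hx hy => rw [add_mul, add_mul]; exact add_mem hx hy
    | smul r _ _ hx => rw [smul_mul_assoc, smul_mul_assoc]; exact Submodule.smul_mem _ r hx
  intro f
  simpa using hff f 1 h1 1 h1

theorem isAzumaya {κ : Type*} [Finite κ] (b : Module.Basis κ R A)
    (hσ : IsCyclicGalois R S p σ) (x y : Fin p → S)
    (hxy : ∀ k : ZMod p, ∑ i, x i * (σ ^ k.val) (y i) = if k = 0 then 1 else 0) :
    IsAzumaya R A := by
  have : Module.Finite R A := .of_basis b
  have : Module.Free R A := .of_basis b
  have : FaithfulSMul R A := by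
    rw [faithfulSMul_iff_algebraMap_injective]
    have : algebraMap R A = G.ι.toRingHom.comp (algebraMap R S) := by
      ext r; simp
    rw [this]
    exact G.injective.comp hσ.injective
  exact { bij := bijective_mulLeftRight_of_surjective b (G.mulLeftRight_surjective hσ x y hxy) }

end CyclicGrading

/-! ### `q`-integers -/

section QInt

variable {R : Type*} [CommRing R]

/-- The `q`-integer `1 + q + ⋯ + q ^ (n - 1)`. -/
def qInt (q : R) (n : ℕ) : R := ∑ i ∈ Finset.range n, q ^ i

@[simp] lemma qInt_zero (q : R) : qInt q 0 = 0 := by simp [qInt]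

lemma qInt_succ (q : R) (n : ℕ) : qInt q (n + 1) = qInt q n + q ^ n := by
  simp [qInt, Finset.sum_range_succ]

lemma qInt_succ' (q : R) (n : ℕ) : qInt q (n + 1) = q * qInt q n + 1 := by
  simp [qInt, Finset.sum_range_succ', Finset.mul_sum, pow_succ']

lemma qInt_add (q : R) (m n : ℕ) : qInt q (m + n) = qInt q m + q ^ m * qInt q n := by
  simp [qInt, Finset.sum_range_add, Finset.mul_sum, pow_add]

lemma sub_one_mul_qInt (q : R) (n : ℕ) : (q - 1) * qInt q n = q ^ n - 1 := mul_geom_sum q n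

variable {q : R} {p : ℕ} (hq : qInt q p = 0)
include hq

lemma pow_eq_one_of_qInt_eq_zero : q ^ p = 1 := by
  rw [← sub_eq_zero, ← sub_one_mul_qInt, hq, mul_zero]

lemma qInt_add_mul (m k : ℕ) : qInt q (m + p * k) = qInt q m := by
  induction k with
  | zero => simp
  | succ k ih => rw [Nat.mul_succ, ← add_assoc, qInt_add, ih, hq, mul_zero, add_zero]

lemma pow_add_mul_of_qInt_eq_zero (m k : ℕ) : q ^ (m + p * k) = q ^ m := by
  rw [pow_add, pow_mul, pow_eq_one_of_qInt_eq_zero hq, one_pow, mul_one]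

/-- The powers of r = q⁻¹ are those of q in reverse order. Straightening monomials produces
coefficients in r. -/
lemma qInt_inv {r : R} (hr : r * q = 1) : qInt r p = 0 := by
  have h : ∀ i ∈ Finset.range p, r ^ i = q * q ^ (p - 1 - i) := by
    intro i hi
    rw [Finset.mem_range] at hi
    calc r ^ i = r ^ i * q ^ (i + (p - 1 - i + 1)) := by
          rw [show i + (p - 1 - i + 1) = p by omega, pow_eq_one_of_qInt_eq_zero hq, mul_one]
      _ = (r * q) ^ i * q ^ (p - 1 - i + 1) := by rw [pow_add, mul_pow]; ring
      _ = q * q ^ (p - 1 - i) := by rw [hr]; ring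
  rw [qInt, Finset.sum_congr rfl h, ← Finset.mul_sum, Finset.sum_range_reflect (fun i => q ^ i) p]
  change q * qInt q p = 0
  rw [hq, mul_zero]

end QInt

/-! ### Transfer of units and identities from ℤ[ρ] -/

section ZRho

variable {p : ℕ} [Fact p.Prime]

lemma eval₂_cyclotomic_prime {R : Type*} [CommRing R] (q : R) :
    (Polynomial.cyclotomic p ℤ).eval₂ (Int.castRingHom R) q = qInt q p := by
  simp [Polynomial.cyclotomic_prime, Polynomial.eval₂_finsetSum, qInt]

/-- The ring homomorphism `ℤ[ρ] → R` sending `ρ` to `q`. -/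
noncomputable def ZRho.liftHom {R : Type*} [CommRing R] {q : R} (hq : qInt q p = 0) :
    ZRho p →+* R :=
  AdjoinRoot.lift (Int.castRingHom R) q (by rw [eval₂_cyclotomic_prime, hq])

@[simp]
lemma ZRho.liftHom_root {R : Type*} [CommRing R] {q : R} (hq : qInt q p = 0) :
    ZRho.liftHom hq (AdjoinRoot.root (Polynomial.cyclotomic p ℤ)) = q :=
  AdjoinRoot.lift_root _

variable (p) in
lemma ZRho.isDomain : IsDomain (ZRho p) :=
  AdjoinRoot.isDomain_of_prime
    (Polynomial.cyclotomic.irreducible (Fact.out : p.Prime).pos).prime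

variable (p) in
lemma ZRho.qInt_root : qInt (AdjoinRoot.root (Polynomial.cyclotomic p ℤ)) p = 0 := by
  rw [← eval₂_cyclotomic_prime, Subsingleton.elim (Int.castRingHom _)
    (AdjoinRoot.of (Polynomial.cyclotomic p ℤ))]
  exact AdjoinRoot.eval₂_root _

variable (p) in
lemma ZRho.isPrimitiveRoot_root :
    IsPrimitiveRoot (AdjoinRoot.root (Polynomial.cyclotomic p ℤ)) p := by
  rw [IsPrimitiveRoot.iff_orderOf]
  refine orderOf_eq_prime (pow_eq_one_of_qInt_eq_zero (ZRho.qInt_root p)) fun h => ?_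
  -- To see ρ ≠ 1, map ℤ[ρ] to ℂ by sending ρ to a nontrivial root of unity.
  have hζ := Complex.isPrimitiveRoot_exp p (Fact.out : p.Prime).ne_zero
  have h0 : qInt (Complex.exp (2 * Real.pi * Complex.I / p)) p = 0 :=
    hζ.geom_sum_eq_zero (Fact.out : p.Prime).one_lt
  have := ZRho.liftHom_root h0
  rw [h, map_one] at this
  exact hζ.ne_one (Fact.out : p.Prime).one_lt this.symm

variable {R : Type*} [CommRing R] {q : R} (hq : qInt q p = 0)
include hq

/-- This is the image of the cyclotomic unit (ρ^i - 1)/(ρ - 1) of ℤ[ρ], as i is prime to p. -/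
lemma isUnit_qInt {i : ℕ} (h0 : 0 < i) (hi : i < p) : IsUnit (qInt q i) := by
  have := ZRho.isDomain p
  have h := ((ZRho.isPrimitiveRoot_root p).geom_sum_isUnit (Fact.out : p.Prime).two_le
    (Nat.Coprime.symm <| (Nat.Prime.coprime_iff_not_dvd (Fact.out : p.Prime)).2
      (Nat.not_dvd_of_pos_of_lt h0 hi))).map (ZRho.liftHom hq)
  rw [map_sum] at h
  simp only [map_pow, ZRho.liftHom_root] at h
  exact h

/-- Over the domain ℤ[ρ][X] this is the factorization of 1 - X^p over the p-th roots of unity; it is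
then specialized along ρ ↦ q, X ↦ t. -/
lemma prod_one_sub_pow_mul (t : R) : ∏ i ∈ Finset.range p, (1 - q ^ i * t) = 1 - t ^ p := by
  have := ZRho.isDomain p
  set ρ := AdjoinRoot.root (Polynomial.cyclotomic p ℤ)
  have hρ := ZRho.isPrimitiveRoot_root p
  have hC : IsPrimitiveRoot (Polynomial.C ρ) p := hρ.map_of_injective Polynomial.C_injective
  have h := hC.pow_sub_pow_eq_prod_sub_mul 1 Polynomial.X (Fact.out : p.Prime).pos
  have h' : ∏ ζ ∈ Polynomial.nthRootsFinset p (1 : Polynomial (ZRho p)), (1 - ζ * Polynomial.X) =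
      ∏ i ∈ Finset.range p, (1 - Polynomial.C ρ ^ i * Polynomial.X) := by
    symm
    refine Finset.prod_nbij (fun i => Polynomial.C ρ ^ i) (fun i _ => ?_) ?_ ?_ (fun _ _ => rfl)
    · rw [Polynomial.mem_nthRootsFinset (Fact.out : p.Prime).pos, ← pow_mul, mul_comm, pow_mul,
        hC.pow_eq_one, one_pow]
    · intro i hi j hj hij
      exact hC.pow_inj (Finset.mem_range.1 hi) (Finset.mem_range.1 hj) hij
    · intro ζ hζ
      obtain ⟨i, hi, rfl⟩ := hC.eq_pow_of_pow_eq_one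
        ((Polynomial.mem_nthRootsFinset (Fact.out : p.Prime).pos _).1 hζ)
      exact ⟨i, Finset.mem_coe.2 (Finset.mem_range.2 hi), rfl⟩
  rw [h'] at h
  have := congrArg (Polynomial.eval₂RingHom (ZRho.liftHom hq) t) h
  rw [map_prod] at this
  simpa [ρ, ← Polynomial.C_pow, -map_pow, map_pow (ZRho.liftHom hq)] using this.symm

end ZRho

/-! ### The monomial basis -/

section QWeylAlgebra

variable {R A : Type*} [CommRing R] [Ring A] [Algebra R A] {q r : R} (hr : r * q = 1) {x y : A}
  (h : x * y - q • (y * x) = 1)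
include hr h

lemma mul_swap_of_qComm : y * x = r • (x * y) - r • 1 := by
  rw [← smul_sub, ← h, sub_sub_cancel, smul_smul, hr, one_smul]

lemma mul_pow_of_qComm (m : ℕ) :
    y * x ^ (m + 1) = r ^ (m + 1) • (x ^ (m + 1) * y) - (r * qInt r (m + 1)) • x ^ m := by
  induction m with
  | zero => simp [mul_swap_of_qComm hr h, qInt]
  | succ m ih =>
    rw [pow_succ x (m + 1), ← mul_assoc, ih, sub_mul, smul_mul_assoc, smul_mul_assoc, mul_assoc,
      mul_swap_of_qComm hr h, mul_sub, mul_smul_comm, mul_smul_comm, mul_one, ← mul_assoc,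
      ← pow_succ, ← pow_succ, smul_sub, smul_smul, smul_smul, sub_sub, ← add_smul, ← pow_succ,
      qInt_succ r (m + 1)]
    congr 2
    ring

lemma pow_mul_of_qComm (n : ℕ) :
    y ^ (n + 1) * x = r ^ (n + 1) • (x * y ^ (n + 1)) - (r * qInt r (n + 1)) • y ^ n := by
  induction n with
  | zero => simp [mul_swap_of_qComm hr h, qInt]
  | succ n ih =>
    rw [pow_succ' y (n + 1), mul_assoc, ih, mul_sub, mul_smul_comm, mul_smul_comm, ← mul_assoc,
      mul_swap_of_qComm hr h, sub_mul, smul_mul_assoc, smul_mul_assoc, one_mul, mul_assoc,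
      ← pow_succ', ← pow_succ', smul_sub, smul_smul, smul_smul, sub_sub, ← add_smul, ← pow_succ,
      qInt_succ r (n + 1)]
    congr 2
    ring

/-- In the straightening rule for y^p x the correction carries the factor [p] = 0, and r^p = 1. -/
lemma commute_pow_of_qComm {p : ℕ} [NeZero p] (hp : qInt r p = 0) : Commute (y ^ p) x := by
  obtain ⟨n, rfl⟩ := Nat.exists_eq_succ_of_ne_zero (NeZero.ne p)
  have := pow_mul_of_qComm hr h n
  rwa [hp, pow_eq_one_of_qInt_eq_zero hp, mul_zero, zero_smul, sub_zero, one_smul] at this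

end QWeylAlgebra

/-! ### The regular representation and independence of the monomials -/

namespace QWeyl

section Rep

variable {R : Type*} [CommRing R] (p : ℕ) [NeZero p] (r a b : R)

/-- The vector standing for `x ^ m y ^ n` in the regular representation. -/
noncomputable def repVec (m n : ℕ) : (Fin p × Fin p) →₀ R :=
  Finsupp.single (Fin.ofNat p m, Fin.ofNat p n) (a ^ (m / p) * b ^ (n / p))

lemma repVec_fin (i j : Fin p) : repVec p a b i j = Finsupp.single (i, j) 1 := by
  simp [repVec, Nat.div_eq_of_lt]

lemma repVec_add_mul (m n k l : ℕ) :
    repVec p a b (m + p * k) (n + p * l) = (a ^ k * b ^ l) • repVec p a b m n := by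
  have e : ∀ m k : ℕ, Fin.ofNat p (m + p * k) = Fin.ofNat p m := fun m k => by
    ext; simp [Fin.ofNat]
  rw [repVec, repVec, Finsupp.smul_single, e, e, Nat.add_mul_div_left _ _ (NeZero.pos p),
    Nat.add_mul_div_left _ _ (NeZero.pos p), smul_eq_mul]
  congr 1
  ring

/-- The action of `x` in the regular representation. -/
noncomputable def repX : Module.End R ((Fin p × Fin p) →₀ R) :=
  Finsupp.linearCombination R fun ij => repVec p a b (ij.1 + 1) ij.2

/-- The action of `y` in the regular representation. -/
noncomputable def repY : Module.End R ((Fin p × Fin p) →₀ R) :=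
  Finsupp.linearCombination R fun ij =>
    r ^ (ij.1 : ℕ) • repVec p a b ij.1 (ij.2 + 1) -
      -- The coefficients are those of `mul_pow_of_qComm`. At exponent 0 the subtraction truncates,
      -- but the coefficient vanishes.
      (r * qInt r ij.1) • repVec p a b (ij.1 - 1) ij.2

lemma exists_repVec (m n : ℕ) : ∃ (i j : Fin p) (k l : ℕ), m = i + p * k ∧ n = j + p * l :=
  ⟨Fin.ofNat p m, Fin.ofNat p n, m / p, n / p, (Nat.mod_add_div m p).symm,
    (Nat.mod_add_div n p).symm⟩

lemma repX_repVec (m n : ℕ) : repX p a b (repVec p a b m n) = repVec p a b (m + 1) n := by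
  obtain ⟨i, j, k, l, rfl, rfl⟩ := exists_repVec p m n
  rw [repVec_add_mul, map_smul, repVec_fin, repX, Finsupp.linearCombination_single, one_smul,
    ← repVec_add_mul, add_right_comm]

lemma repY_repVec (hr : qInt r p = 0) (m n : ℕ) : repY p r a b (repVec p a b m n) =
    r ^ m • repVec p a b m (n + 1) - (r * qInt r m) • repVec p a b (m - 1) n := by
  obtain ⟨i, j, k, l, rfl, rfl⟩ := exists_repVec p m n
  rw [repVec_add_mul, map_smul, repVec_fin, repY, Finsupp.linearCombination_single, one_smul,
    smul_sub, smul_comm, ← repVec_add_mul, add_right_comm, pow_add_mul_of_qInt_eq_zero hr,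
    qInt_add_mul hr, smul_comm, ← repVec_add_mul]
  congr 1
  by_cases hi : (i : ℕ) = 0
  · simp [hi]
  · rw [show (i : ℕ) + p * k - 1 = i - 1 + p * k by omega]

lemma repVec_ext {f g : Module.End R ((Fin p × Fin p) →₀ R)}
    (h : ∀ m n, f (repVec p a b m n) = g (repVec p a b m n)) : f = g := by
  refine Finsupp.basisSingleOne.ext fun ij => ?_
  simpa [repVec_fin] using h ij.1 ij.2

lemma repX_pow_repVec (k m n : ℕ) :
    (repX p a b ^ k) (repVec p a b m n) = repVec p a b (m + k) n := by
  induction k with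
  | zero => simp
  | succ k ih => rw [pow_succ', Module.End.mul_apply, ih, repX_repVec, add_assoc]

lemma repY_pow_repVec (hr : qInt r p = 0) (k n : ℕ) :
    (repY p r a b ^ k) (repVec p a b 0 n) = repVec p a b 0 (n + k) := by
  induction k with
  | zero => simp
  | succ k ih =>
    rw [pow_succ', Module.End.mul_apply, ih, repY_repVec p r a b hr]
    simp [add_assoc]

variable {q : R}

lemma repX_mul_repY (hr : qInt r p = 0) (hrq : r * q = 1) :
    repX p a b * repY p r a b - q • (repY p r a b * repX p a b) = 1 := by
  refine repVec_ext p a b fun m n => ?_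
  rw [LinearMap.sub_apply, LinearMap.smul_apply, Module.End.mul_apply, Module.End.mul_apply,
    repX_repVec, repY_repVec p r a b hr, repY_repVec p r a b hr, map_sub, map_smul, map_smul,
    repX_repVec, repX_repVec, smul_sub, smul_smul, smul_smul, Module.End.one_apply,
    Nat.add_sub_cancel]
  have e : (r * qInt r m) • repVec p a b (m - 1 + 1) n = (r * qInt r m) • repVec p a b m n := by
    cases m <;> simp
  rw [e, show q * r ^ (m + 1) = r ^ m by linear_combination r ^ m * hrq,
    show q * (r * qInt r (m + 1)) = qInt r (m + 1) by linear_combination qInt r (m + 1) * hrq,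
    qInt_succ', add_smul, one_smul]
  abel

lemma repX_pow : repX p a b ^ p = algebraMap R _ a := by
  refine repVec_ext p a b fun m n => ?_
  rw [repX_pow_repVec, Module.algebraMap_end_apply]
  simpa using repVec_add_mul p a b m n 1 0

lemma repY_pow (hr : qInt r p = 0) (hrq : r * q = 1) : repY p r a b ^ p = algebraMap R _ b := by
  -- As y^p commutes with x, it suffices to compute it on the vectors of y^n, where y acts by a
  -- plain shift.
  have hcomm : Commute (repY p r a b ^ p) (repX p a b) :=
    commute_pow_of_qComm (A := Module.End R ((Fin p × Fin p) →₀ R)) hrq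
      (repX_mul_repY p r a b hr hrq) hr
  refine repVec_ext p a b fun m n => ?_
  have hm : repVec p a b m n = (repX p a b ^ m) (repVec p a b 0 n) := by
    rw [repX_pow_repVec, zero_add]
  rw [hm, ← Module.End.mul_apply, (hcomm.pow_right m).eq, Module.End.mul_apply,
    repY_pow_repVec p r a b hr, Module.algebraMap_end_apply, ← map_smul]
  congr 1
  simpa using repVec_add_mul p a b 0 n 0 1

end Rep

/-! ### The presented algebra and its monomial basis -/

section Presentation

variable {R : Type*} [CommRing R] (p : ℕ) (q a b : R)

lemma comm_rel : x p q a b * y p q a b - q • (y p q a b * x p q a b) = 1 := by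
  simpa [x, y] using RingQuot.mkAlgHom_rel R (QWeylRel.comm (p := p) (q := q) (a := a) (b := b))

lemma x_pow : x p q a b ^ p = algebraMap R _ a := by
  simpa [x] using RingQuot.mkAlgHom_rel R (QWeylRel.x_pow (p := p) (q := q) (a := a) (b := b))

lemma y_pow : y p q a b ^ p = algebraMap R _ b := by
  simpa [y] using RingQuot.mkAlgHom_rel R (QWeylRel.y_pow (p := p) (q := q) (a := a) (b := b))

variable {p q a b}

/-- The universal property of the algebra generated by `x`, `y` subject to the relations. -/
noncomputable def lift {A : Type*} [Ring A] [Algebra R A] (X Y : A)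
    (h : X * Y - q • (Y * X) = 1) (hX : X ^ p = algebraMap R A a) (hY : Y ^ p = algebraMap R A b) :
    QWeyl p q a b →ₐ[R] A :=
  RingQuot.liftAlgHom R ⟨FreeAlgebra.lift R ![X, Y], by
    intro _ _ hrel
    induction hrel with
    | comm => simpa using h
    | x_pow => simpa using hX
    | y_pow => simpa using hY⟩

section
variable {A : Type*} [Ring A] [Algebra R A] {X Y : A}
    (h : X * Y - q • (Y * X) = 1) (hX : X ^ p = algebraMap R A a) (hY : Y ^ p = algebraMap R A b)

@[simp] lemma lift_x : lift X Y h hX hY (x p q a b) = X := by simp [lift, x]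

@[simp] lemma lift_y : lift X Y h hX hY (y p q a b) = Y := by simp [lift, y]
end

/-- A submodule containing `1` and stable under left multiplication by `x` and `y` is everything. -/
lemma eq_top_of_stable (W : Submodule R (QWeyl p q a b)) (h1 : 1 ∈ W)
    (hx : ∀ w ∈ W, x p q a b * w ∈ W) (hy : ∀ w ∈ W, y p q a b * w ∈ W) : W = ⊤ := by
  have stab : ∀ f : FreeAlgebra R (Fin 2), ∀ w ∈ W,
      RingQuot.mkAlgHom R (QWeylRel p q a b) f * w ∈ W := by
    intro f
    induction f using FreeAlgebra.induction with
    | grade0 r =>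
      intro w hw
      rw [AlgHom.commutes, ← Algebra.smul_def]
      exact W.smul_mem r hw
    | grade1 i =>
      intro w hw
      fin_cases i
      · exact hx w hw
      · exact hy w hw
    | mul f g hf hg =>
      intro w hw
      rw [map_mul, mul_assoc]
      exact hf _ (hg _ hw)
    | add f g hf hg =>
      intro w hw
      rw [map_add, add_mul]
      exact add_mem (hf _ hw) (hg _ hw)
  rw [eq_top_iff]
  intro w _
  obtain ⟨f, rfl⟩ := RingQuot.mkAlgHom_surjective R (QWeylRel p q a b) w
  simpa using stab f 1 h1

variable [NeZero p]

lemma span_monomials (hq : qInt q p = 0) : ⊤ ≤ Submodule.span R (Set.range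
    fun ij : Fin p × Fin p => x p q a b ^ (ij.1 : ℕ) * y p q a b ^ (ij.2 : ℕ)) := by
  set W := Submodule.span R (Set.range
    fun ij : Fin p × Fin p => x p q a b ^ (ij.1 : ℕ) * y p q a b ^ (ij.2 : ℕ)) with hW
  have hmem : ∀ m n : ℕ, x p q a b ^ m * y p q a b ^ n ∈ W := by
    intro m n
    obtain ⟨i, j, k, l, rfl, rfl⟩ := exists_repVec p m n
    rw [pow_add, pow_add, pow_mul, pow_mul, x_pow, y_pow, ← map_pow, ← map_pow,
      ← Algebra.commutes, ← Algebra.commutes (b ^ l), mul_assoc, ← mul_assoc (x p q a b ^ (i : ℕ)),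
      ← Algebra.commutes (b ^ l), mul_assoc, ← Algebra.smul_def, ← Algebra.smul_def]
    exact W.smul_mem _ (W.smul_mem _ (Submodule.subset_span ⟨(i, j), rfl⟩))
  have hr : q ^ (p - 1) * q = 1 := by
    rw [← pow_succ, Nat.sub_add_cancel (NeZero.pos p), pow_eq_one_of_qInt_eq_zero hq]
  refine (eq_top_of_stable W (by simpa using hmem 0 0) ?_ ?_).ge
  · intro w hw
    induction hw using Submodule.span_induction with
    | mem _ h =>
      obtain ⟨ij, rfl⟩ := h
      simpa only [← mul_assoc, ← pow_succ'] using hmem (ij.1 + 1) ij.2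
    | zero => rw [mul_zero]; exact zero_mem _
    | add _ _ _ _ h h' => rw [mul_add]; exact add_mem h h'
    | smul s _ _ h => rw [mul_smul_comm]; exact W.smul_mem s h
  · intro w hw
    induction hw using Submodule.span_induction with
    | mem _ h =>
      obtain ⟨⟨i, j⟩, rfl⟩ := h
      change y p q a b * (x p q a b ^ (i : ℕ) * y p q a b ^ (j : ℕ)) ∈ W
      rcases (i : ℕ) with _ | i
      · simpa only [pow_zero, one_mul, ← pow_succ'] using hmem 0 (j + 1)
      · rw [← mul_assoc, mul_pow_of_qComm hr (comm_rel p q a b), sub_mul, smul_mul_assoc,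
          smul_mul_assoc, mul_assoc, ← pow_succ']
        exact sub_mem (W.smul_mem _ (hmem _ _)) (W.smul_mem _ (hmem _ _))
    | zero => rw [mul_zero]; exact zero_mem _
    | add _ _ _ _ h h' => rw [mul_add]; exact add_mem h h'
    | smul s _ _ h => rw [mul_smul_comm]; exact W.smul_mem s h

/-- Acting on the vector of 1, the monomials produce the standard basis of the regular
representation. -/
lemma linearIndependent_monomials (hq : qInt q p = 0) : LinearIndependent R
    fun ij : Fin p × Fin p => x p q a b ^ (ij.1 : ℕ) * y p q a b ^ (ij.2 : ℕ) := by
  have hrq : q ^ (p - 1) * q = 1 := by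
    rw [← pow_succ, Nat.sub_add_cancel (NeZero.pos p), pow_eq_one_of_qInt_eq_zero hq]
  have hr := qInt_inv hq hrq
  let ρ : QWeyl p q a b →ₐ[R] Module.End R ((Fin p × Fin p) →₀ R) :=
    lift (repX p a b) (repY p (q ^ (p - 1)) a b) (repX_mul_repY p _ a b hr hrq)
      (repX_pow p a b) (repY_pow p _ a b hr hrq)
  refine LinearIndependent.of_comp ((LinearMap.applyₗ (repVec p a b 0 0)).comp ρ.toLinearMap) ?_
  convert (Finsupp.basisSingleOne (R := R) (ι := Fin p × Fin p)).linearIndependent using 1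
  ext1 ⟨i, j⟩
  have hx : ρ (x p q a b) = repX p a b := lift_x _ _ _
  have hy : ρ (y p q a b) = repY p (q ^ (p - 1)) a b := lift_y _ _ _
  simp [hx, hy, Module.End.mul_apply, repY_pow_repVec p _ a b hr, repX_pow_repVec, repVec_fin]

/-- The basis of the monomials `x ^ i y ^ j`. -/
noncomputable def monomialBasis (a b : R) (hq : qInt q p = 0) :
    Module.Basis (Fin p × Fin p) R (QWeyl p q a b) :=
  .mk (linearIndependent_monomials hq) (span_monomials hq)

@[simp]
lemma monomialBasis_apply (hq : qInt q p = 0) (ij : Fin p × Fin p) :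
    monomialBasis a b hq ij = x p q a b ^ (ij.1 : ℕ) * y p q a b ^ (ij.2 : ℕ) := by
  simp [monomialBasis]

lemma coord_one (a b : R) (hq : qInt q p = 0) : (monomialBasis a b hq).coord (0, 0) 1 = 1 := by
  have : monomialBasis a b hq (0, 0) = 1 := by simp
  rw [← this, Module.Basis.coord_apply, Module.Basis.repr_self, Finsupp.single_eq_same]

lemma algebraMap_injective (a b : R) (hq : qInt q p = 0) :
    Function.Injective (algebraMap R (QWeyl p q a b)) := fun r s h => by
  have := congrArg ((monomialBasis a b hq).coord (0, 0)) h
  simpa [Algebra.algebraMap_eq_smul_one, -Module.Basis.coord_apply, coord_one] using this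

theorem hasMonomialBasis (hq : qInt q p = 0) : HasMonomialBasis p q a b :=
  ⟨monomialBasis a b hq, fun i j => monomialBasis_apply hq (i, j)⟩

end Presentation

end QWeyl

/-! ### The commutative subring generated by `xy` -/

section NormPoly

variable {R : Type*} [CommRing R]

/-- The polynomial `∏ i < n, ([i] + q ^ i Z)`, which takes the value `x ^ n y ^ n` at `xy`. -/
noncomputable def normPoly (q : R) (n : ℕ) : Polynomial R :=
  ∏ i ∈ Finset.range n, (Polynomial.C (qInt q i) + Polynomial.C (q ^ i) * Polynomial.X)

lemma normPoly_succ (q : R) (n : ℕ) : normPoly q (n + 1) =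
    (Polynomial.C (qInt q n) + Polynomial.C (q ^ n) * Polynomial.X) * normPoly q n := by
  rw [normPoly, Finset.prod_range_succ, mul_comm, normPoly]

lemma natDegree_normPoly_le (q : R) (n : ℕ) : (normPoly q n).natDegree ≤ n := by
  induction n with
  | zero => simp [normPoly]
  | succ n ih =>
    rw [normPoly_succ, add_comm n]
    refine Polynomial.natDegree_mul_le.trans (add_le_add ?_ ih)
    rw [add_comm]
    exact Polynomial.natDegree_linear_le

lemma aeval_normPoly {T : Type*} [CommRing T] [Algebra R T] (q : R) (n : ℕ) (t : T) :
    Polynomial.aeval t (normPoly q n) =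
      ∏ i ∈ Finset.range n, (algebraMap R T (qInt q i) + q ^ i • t) := by
  rw [normPoly, map_prod]
  exact Finset.prod_congr rfl fun i _ => by
    rw [map_add, map_mul, Polynomial.aeval_C, Polynomial.aeval_C, Polynomial.aeval_X,
      Algebra.smul_def]

/-- The substitution shifts the factor of index i to index i + 1, and the factor of index p equals
that of index 0. This makes σ well defined on S. -/
lemma aeval_one_add_normPoly {T : Type*} [CommRing T] [Algebra R T] {q : R} {p : ℕ}
    (hq : qInt q p = 0) (t : T) :
    Polynomial.aeval (1 + q • t) (normPoly q p) = Polynomial.aeval t (normPoly q p) := by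
  set f : ℕ → T := fun i => algebraMap R T (qInt q i) + q ^ i • t with hf
  have hp : f p = f 0 := by simp [hf, hq, pow_eq_one_of_qInt_eq_zero hq]
  have h : ∀ i, algebraMap R T (qInt q i) + q ^ i • (1 + q • t) = f (i + 1) := fun i => by
    simp only [hf, qInt_succ, add_smul, smul_add, smul_smul, ← pow_succ,
      Algebra.algebraMap_eq_smul_one, add_assoc]
  rw [aeval_normPoly, aeval_normPoly, Finset.prod_congr rfl fun i _ => h i]
  cases p with
  | zero => simp
  | succ n => rw [Finset.prod_range_succ, hp, Finset.prod_range_succ']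

section Noncomm

variable {A : Type*} [Ring A] [Algebra R A] {q : R} {x y : A} (h : x * y - q • (y * x) = 1)
include h

lemma x_mul_xy : x * (x * y) = (1 + q • (x * y)) * x := by
  have h' : x * y = 1 + q • (y * x) := by rw [← h]; abel
  conv_lhs => rw [h', mul_add, mul_one, mul_smul_comm, ← mul_assoc]
  rw [add_mul, one_mul, smul_mul_assoc]

lemma y_mul_one_add : y * (1 + q • (x * y)) = x * y * y := by
  have h' : x * y = 1 + q • (y * x) := by rw [← h]; abel
  conv_rhs => rw [h', add_mul, one_mul, smul_mul_assoc]
  rw [mul_add, mul_one, mul_smul_comm, mul_assoc]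

lemma x_pow_mul_xy (n : ℕ) :
    x ^ n * (x * y) = (algebraMap R A (qInt q n) + q ^ n • (x * y)) * x ^ n := by
  induction n with
  | zero => simp
  | succ n ih =>
    rw [pow_succ', mul_assoc, ih, ← mul_assoc, mul_add, ← Algebra.commutes, mul_smul_comm,
      x_mul_xy h, ← smul_mul_assoc, ← add_mul, mul_assoc, qInt_succ, map_add, smul_add, smul_smul,
      ← pow_succ, add_assoc, ← Algebra.algebraMap_eq_smul_one]

lemma aeval_xy_normPoly (n : ℕ) : Polynomial.aeval (x * y) (normPoly q n) = x ^ n * y ^ n := by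
  induction n with
  | zero => simp [normPoly]
  | succ n ih =>
    rw [normPoly_succ, map_mul, ih, map_add, map_mul, Polynomial.aeval_C, Polynomial.aeval_C,
      Polynomial.aeval_X, ← Algebra.smul_def, ← mul_assoc, ← x_pow_mul_xy h, pow_succ x, pow_succ' y]
    simp only [mul_assoc]

end Noncomm

end NormPoly

/-- The commutative `R`-algebra generated by `z` subject to `∏ i < p, ([i] + q ^ i z) = ab`. -/
def QBase {R : Type u} [CommRing R] (p : ℕ) (q a b : R) : Type u :=
  AdjoinRoot (normPoly q p - Polynomial.C (a * b))

namespace QBase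

variable {R : Type*} [CommRing R] (p : ℕ) (q a b : R)

noncomputable instance : CommRing (QBase p q a b) :=
  inferInstanceAs (CommRing (AdjoinRoot (normPoly q p - Polynomial.C (a * b))))

noncomputable instance : Algebra R (QBase p q a b) :=
  inferInstanceAs (Algebra R (AdjoinRoot (normPoly q p - Polynomial.C (a * b))))

/-- The generator. -/
noncomputable def z : QBase p q a b := AdjoinRoot.root (normPoly q p - Polynomial.C (a * b))

lemma adjoin_z : Algebra.adjoin R {z p q a b} = ⊤ :=
  AdjoinRoot.adjoinRoot_eq_top (f := normPoly q p - Polynomial.C (a * b))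

lemma aeval_z_normPoly :
    Polynomial.aeval (z p q a b) (normPoly q p) = algebraMap R _ (a * b) := by
  have : Polynomial.aeval (z p q a b) (normPoly q p - Polynomial.C (a * b)) = 0 :=
    (AdjoinRoot.aeval_eq _).trans AdjoinRoot.mk_self
  rwa [map_sub, Polynomial.aeval_C, sub_eq_zero] at this

variable {p q a b}

@[elab_as_elim]
lemma induction {motive : QBase p q a b → Prop} (s : QBase p q a b)
    (algebraMap : ∀ r, motive (algebraMap R _ r)) (z : motive (z p q a b))
    (add : ∀ s t, motive s → motive t → motive (s + t))
    (mul : ∀ s t, motive s → motive t → motive (s * t)) : motive s := by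
  have hs : s ∈ Algebra.adjoin R {QBase.z p q a b} := by rw [adjoin_z]; trivial
  induction hs using Algebra.adjoin_induction with
  | mem x hx => rw [Set.mem_singleton_iff.1 hx]; exact z
  | algebraMap r => exact algebraMap r
  | add x y _ _ hx hy => exact add x y hx hy
  | mul x y _ _ hx hy => exact mul x y hx hy

/-- The universal property. -/
noncomputable def lift {A : Type*} [Ring A] [Algebra R A] (t : A)
    (ht : Polynomial.aeval t (normPoly q p) = algebraMap R A (a * b)) : QBase p q a b →ₐ[R] A :=
  Ideal.Quotient.liftₐ (Ideal.span {normPoly q p - Polynomial.C (a * b)}) (Polynomial.aeval t) (fun f hf => by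
    obtain ⟨g, rfl⟩ := Ideal.mem_span_singleton'.1 hf
    rw [map_mul, map_sub, ht, Polynomial.aeval_C, sub_self, mul_zero])

@[simp]
lemma lift_z {A : Type*} [Ring A] [Algebra R A] (t : A)
    (ht : Polynomial.aeval t (normPoly q p) = algebraMap R A (a * b)) :
    lift t ht (z p q a b) = t :=
  (Ideal.Quotient.liftₐ_apply _ _ _ _).trans (Polynomial.aeval_X t)

lemma algHom_ext {A : Type*} [Ring A] [Algebra R A] {f g : QBase p q a b →ₐ[R] A}
    (h : f (z p q a b) = g (z p q a b)) : f = g := by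
  ext s
  induction s using induction with
  | algebraMap r => simp
  | z => exact h
  | add s t hs ht => rw [map_add, map_add, hs, ht]
  | mul s t hs ht => rw [map_mul, map_mul, hs, ht]

section Sigma

variable (a b)

/-- The endomorphism sending `z` to `1 + q z`. -/
noncomputable def sigmaHom (hq : qInt q p = 0) : QBase p q a b →ₐ[R] QBase p q a b :=
  lift (1 + q • z p q a b) (by
    rw [aeval_one_add_normPoly hq, aeval_z_normPoly])

variable (hq : qInt q p = 0)

lemma sigmaHom_z : sigmaHom a b hq (z p q a b) = 1 + q • z p q a b := lift_z _ _

lemma sigmaHom_pow_z (n : ℕ) : (sigmaHom a b hq ^ n) (z p q a b) =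
    algebraMap R _ (qInt q n) + q ^ n • z p q a b := by
  induction n with
  | zero => simp
  | succ n ih =>
    rw [pow_succ', AlgHom.mul_apply, ih, map_add, map_smul, AlgHom.commutes, sigmaHom_z, qInt_succ,
      map_add, smul_add, smul_smul, ← pow_succ, add_assoc, ← Algebra.algebraMap_eq_smul_one]

lemma sigmaHom_pow : sigmaHom a b hq ^ p = 1 := by
  refine algHom_ext ?_
  rw [sigmaHom_pow_z, hq, pow_eq_one_of_qInt_eq_zero hq]
  simp

variable [NeZero p]

/-- The automorphism sending `z` to `1 + q z`. -/
noncomputable def sigma : QBase p q a b ≃ₐ[R] QBase p q a b :=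
  AlgEquiv.ofAlgHom (sigmaHom a b hq) (sigmaHom a b hq ^ (p - 1))
    (by
      change sigmaHom a b hq * sigmaHom a b hq ^ (p - 1) = 1
      rw [← pow_succ', Nat.sub_add_cancel (NeZero.pos p), sigmaHom_pow])
    (by
      change sigmaHom a b hq ^ (p - 1) * sigmaHom a b hq = 1
      rw [← pow_succ, Nat.sub_add_cancel (NeZero.pos p), sigmaHom_pow])

lemma sigma_z : sigma a b hq (z p q a b) = 1 + q • z p q a b := sigmaHom_z a b hq

lemma sigma_pow_z (n : ℕ) : (sigma a b hq ^ n) (z p q a b) =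
    algebraMap R _ (qInt q n) + q ^ n • z p q a b := by
  induction n with
  | zero => simp
  | succ n ih =>
    rw [pow_succ', AlgEquiv.mul_apply, ih, map_add, map_smul, AlgEquiv.commutes, sigma_z, qInt_succ,
      map_add, smul_add, smul_smul, ← pow_succ, add_assoc, ← Algebra.algebraMap_eq_smul_one]

lemma sigma_pow : sigma a b hq ^ p = 1 := by
  have : ((sigma a b hq ^ p : QBase p q a b ≃ₐ[R] QBase p q a b) :
      QBase p q a b →ₐ[R] QBase p q a b) = AlgHom.id R _ := by
    refine algHom_ext ?_
    change (sigma a b hq ^ p) (z p q a b) = z p q a b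
    rw [sigma_pow_z, hq, pow_eq_one_of_qInt_eq_zero hq]
    simp
  exact AlgEquiv.ext fun s => DFunLike.congr_fun this s

end Sigma

section Incl

/-- The homomorphism to the algebra generated by `x` and `y` sending `z` to `xy`. -/
noncomputable def toQWeyl (p : ℕ) (q a b : R) : QBase p q a b →ₐ[R] QWeyl p q a b :=
  lift (QWeyl.x p q a b * QWeyl.y p q a b) (by
    rw [aeval_xy_normPoly (QWeyl.comm_rel p q a b), QWeyl.x_pow, QWeyl.y_pow, map_mul])

@[simp]
lemma toQWeyl_z : toQWeyl p q a b (z p q a b) = QWeyl.x p q a b * QWeyl.y p q a b := lift_z _ _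

lemma toQWeyl_aeval (n : ℕ) :
    toQWeyl p q a b (Polynomial.aeval (z p q a b) (normPoly q n)) =
      QWeyl.x p q a b ^ n * QWeyl.y p q a b ^ n := by
  rw [← Polynomial.aeval_algHom_apply, toQWeyl_z, aeval_xy_normPoly (QWeyl.comm_rel p q a b)]

lemma range_toQWeyl : (toQWeyl p q a b).range = QWeyl.adjoinXY p q a b := by
  rw [← Algebra.map_top, ← adjoin_z, AlgHom.map_adjoin, Set.image_singleton, toQWeyl_z]
  rfl

lemma span_aeval_normPoly [NeZero p] (hq : qInt q p = 0) : ⊤ ≤ Submodule.span R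
    (Set.range fun n : Fin p => Polynomial.aeval (z p q a b) (normPoly q n)) := by
  set W := Submodule.span R
    (Set.range fun n : Fin p => Polynomial.aeval (z p q a b) (normPoly q n)) with hW
  have h1 : (1 : QBase p q a b) ∈ W := Submodule.subset_span ⟨0, by simp [normPoly]⟩
  have hsucc : ∀ n : Fin p, Polynomial.aeval (z p q a b) (normPoly q (n + 1)) ∈ W := by
    intro n
    rcases Nat.lt_or_ge (n + 1) p with hn | hn
    · exact Submodule.subset_span ⟨⟨n + 1, hn⟩, rfl⟩
    · rw [show (n : ℕ) + 1 = p by omega, aeval_z_normPoly, Algebra.algebraMap_eq_smul_one]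
      exact W.smul_mem _ h1
  have hrq : q ^ (p - 1) * q = 1 := by
    rw [← pow_succ, Nat.sub_add_cancel (NeZero.pos p), pow_eq_one_of_qInt_eq_zero hq]
  have hz : ∀ w ∈ W, z p q a b * w ∈ W := by
    intro w hw
    induction hw using Submodule.span_induction with
    | mem _ h =>
      obtain ⟨n, rfl⟩ := h
      -- The recursion for `normPoly` solved for the product with z, with q^(p-1) serving as q⁻¹.
      have e : z p q a b * Polynomial.aeval (z p q a b) (normPoly q n) =
          (q ^ (p - 1)) ^ (n : ℕ) • (Polynomial.aeval (z p q a b) (normPoly q (n + 1)) -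
            qInt q n • Polynomial.aeval (z p q a b) (normPoly q n)) := by
        rw [normPoly_succ, map_mul, map_add, map_mul, Polynomial.aeval_C, Polynomial.aeval_C,
          Polynomial.aeval_X, add_mul, Algebra.smul_def (qInt q n), add_sub_cancel_left, mul_assoc,
          ← Algebra.smul_def, smul_smul, ← mul_pow, hrq, one_pow, one_smul]
      rw [e]
      exact W.smul_mem _ (sub_mem (hsucc n) (W.smul_mem _ (Submodule.subset_span ⟨n, rfl⟩)))
    | zero => rw [mul_zero]; exact zero_mem _
    | add _ _ _ _ h h' => rw [mul_add]; exact add_mem h h'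
    | smul s _ _ h => rw [mul_smul_comm]; exact W.smul_mem s h
  have hall : ∀ s : QBase p q a b, ∀ w ∈ W, s * w ∈ W := by
    intro s
    induction s using induction with
    | algebraMap r => intro w hw; rw [← Algebra.smul_def]; exact W.smul_mem r hw
    | z => exact hz
    | add s t hs ht => intro w hw; rw [add_mul]; exact add_mem (hs w hw) (ht w hw)
    | mul s t hs ht => intro w hw; rw [mul_assoc]; exact hs _ (ht w hw)
  intro s _
  simpa using hall s 1 h1

/-- The images are the diagonal monomials x^n y^n, part of the monomial basis. -/
lemma linearIndependent_toQWeyl [NeZero p] (hq : qInt q p = 0) :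
    LinearIndependent R ((toQWeyl p q a b).toLinearMap ∘
      fun n : Fin p => Polynomial.aeval (z p q a b) (normPoly q n)) := by
  have := (QWeyl.linearIndependent_monomials (a := a) (b := b) hq).comp (fun n : Fin p => (n, n))
    (fun m n h => congrArg Prod.fst h)
  convert this using 1
  ext1 n
  exact toQWeyl_aeval (n : ℕ)

/-- A basis of the commutative subring generated by `xy`. -/
noncomputable def basis [NeZero p] (a b : R) (hq : qInt q p = 0) :
    Module.Basis (Fin p) R (QBase p q a b) :=
  .mk (.of_comp _ (linearIndependent_toQWeyl hq)) (span_aeval_normPoly hq)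

lemma toQWeyl_injective [NeZero p] (hq : qInt q p = 0) :
    Function.Injective (toQWeyl p q a b) := by
  have h := linearIndependent_toQWeyl (a := a) (b := b) hq
  have hb : (toQWeyl p q a b).toLinearMap =
      (basis a b hq).constr R ((toQWeyl p q a b).toLinearMap ∘
      fun n : Fin p => Polynomial.aeval (z p q a b) (normPoly q n)) :=
    (basis a b hq).ext fun n => by
      rw [Module.Basis.constr_basis, basis, Module.Basis.mk_apply]
      rfl
  have : Function.Injective (toQWeyl p q a b).toLinearMap := by
    rw [hb]
    exact (basis a b hq).injective_constr_of_linearIndependent h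
  exact this

variable [NeZero p] (hq : qInt q p = 0)

lemma x_mul_toQWeyl (s : QBase p q a b) : QWeyl.x p q a b * toQWeyl p q a b s =
    toQWeyl p q a b (sigma a b hq s) * QWeyl.x p q a b := by
  induction s using induction with
  | algebraMap r => simp [Algebra.commutes]
  | z => simpa [sigma_z] using x_mul_xy (QWeyl.comm_rel p q a b)
  | add s t hs ht => rw [map_add, mul_add, hs, ht, map_add, map_add, add_mul]
  | mul s t hs ht => rw [map_mul, ← mul_assoc, hs, mul_assoc, ht, map_mul, map_mul, mul_assoc]

lemma y_mul_toQWeyl (s : QBase p q a b) :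
    QWeyl.y p q a b * toQWeyl p q a b (sigma a b hq s) =
      toQWeyl p q a b s * QWeyl.y p q a b := by
  induction s using induction with
  | algebraMap r => simp [Algebra.commutes]
  | z => simpa [sigma_z] using y_mul_one_add (QWeyl.comm_rel p q a b)
  | add s t hs ht => rw [map_add, map_add, mul_add, hs, ht, map_add, add_mul]
  | mul s t hs ht => rw [map_mul, map_mul, ← mul_assoc, hs, mul_assoc, ht, map_mul, mul_assoc]

lemma x_pow_mul_toQWeyl (n : ℕ) (s : QBase p q a b) : QWeyl.x p q a b ^ n * toQWeyl p q a b s =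
    toQWeyl p q a b ((sigma a b hq ^ n) s) * QWeyl.x p q a b ^ n := by
  induction n with
  | zero => simp
  | succ n ih =>
    rw [pow_succ', mul_assoc, ih, ← mul_assoc, x_mul_toQWeyl hq, mul_assoc, pow_succ',
      AlgEquiv.mul_apply]

lemma y_pow_mul_toQWeyl (n : ℕ) (s : QBase p q a b) :
    QWeyl.y p q a b ^ n * toQWeyl p q a b ((sigma a b hq ^ n) s) =
      toQWeyl p q a b s * QWeyl.y p q a b ^ n := by
  induction n with
  | zero => simp
  | succ n ih =>
    rw [pow_succ, mul_assoc, pow_succ', AlgEquiv.mul_apply, y_mul_toQWeyl hq, ← mul_assoc, ih,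
      mul_assoc, ← pow_succ]

/-- The degree of commutation of a monomial with the subring generated by `xy`. -/
lemma monomial_mul_toQWeyl {i j : ℕ} {k : ZMod p} (h : (i : ZMod p) - j = k) (s : QBase p q a b) :
    QWeyl.x p q a b ^ i * QWeyl.y p q a b ^ j * toQWeyl p q a b s =
      toQWeyl p q a b ((sigma a b hq ^ k.val) s) *
        (QWeyl.x p q a b ^ i * QWeyl.y p q a b ^ j) := by
  -- The rule for y^j is stated for values of σ^j, which avoids negative powers of σ.
  obtain ⟨t, rfl⟩ := (sigma a b hq ^ j).surjective s
  have e : (sigma a b hq ^ k.val) ((sigma a b hq ^ j) t) = (sigma a b hq ^ i) t := by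
    rw [← AlgEquiv.mul_apply, ← pow_add]
    congr 1
    refine pow_eq_pow_of_modEq ?_ (sigma_pow a b hq)
    rw [← ZMod.natCast_eq_natCast_iff, Nat.cast_add, ZMod.natCast_zmod_val, ← h, sub_add_cancel]
  rw [e, mul_assoc, y_pow_mul_toQWeyl hq, ← mul_assoc, x_pow_mul_toQWeyl hq, mul_assoc]

end Incl

end QBase

/-! ### The grading -/

namespace QWeyl

variable {R : Type*} [CommRing R] (p : ℕ) (q a b : R)

/-- The coaction defining the grading in which `x` has degree `1` and `y` has degree `-1`. -/
noncomputable def coaction :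
    QWeyl p q a b →ₐ[R] AddMonoidAlgebra (QWeyl p q a b) (ZMod p) :=
  lift (q := q) (a := a) (b := b) (AddMonoidAlgebra.single (1 : ZMod p) (x p q a b))
    (AddMonoidAlgebra.single (-1 : ZMod p) (y p q a b))
    (by
      rw [AddMonoidAlgebra.single_mul_single, AddMonoidAlgebra.single_mul_single,
        AddMonoidAlgebra.smul_single, add_neg_cancel, neg_add_cancel, ← AddMonoidAlgebra.single_sub,
        comm_rel, AddMonoidAlgebra.one_def])
    (by
      rw [AddMonoidAlgebra.single_pow, x_pow, nsmul_one, ZMod.natCast_self]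
      rfl)
    (by
      rw [AddMonoidAlgebra.single_pow, y_pow, smul_neg, nsmul_one, ZMod.natCast_self, neg_zero]
      rfl)

/-- The homogeneous elements of degree `k`. -/
noncomputable def gradedPart (k : ZMod p) : Submodule R (QWeyl p q a b) :=
  LinearMap.eqLocus (coaction p q a b).toLinearMap (AddMonoidAlgebra.lsingle k)

variable {p q a b}

lemma mem_gradedPart {k : ZMod p} {v : QWeyl p q a b} :
    v ∈ gradedPart p q a b k ↔ coaction p q a b v = AddMonoidAlgebra.single k v := Iff.rfl

lemma x_mem : x p q a b ∈ gradedPart p q a b 1 := by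
  rw [mem_gradedPart, coaction, lift_x]

lemma y_mem : y p q a b ∈ gradedPart p q a b (-1) := by
  rw [mem_gradedPart, coaction, lift_y]

lemma one_mem_gradedPart : 1 ∈ gradedPart p q a b 0 := by
  rw [mem_gradedPart, map_one, AddMonoidAlgebra.one_def]

lemma mul_mem_gradedPart {k l : ZMod p} {v w : QWeyl p q a b} (hv : v ∈ gradedPart p q a b k)
    (hw : w ∈ gradedPart p q a b l) : v * w ∈ gradedPart p q a b (k + l) := by
  rw [mem_gradedPart] at *
  rw [map_mul, hv, hw, AddMonoidAlgebra.single_mul_single]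

lemma pow_mem_gradedPart {k : ZMod p} {v : QWeyl p q a b} (hv : v ∈ gradedPart p q a b k) (n : ℕ) :
    v ^ n ∈ gradedPart p q a b (n * k) := by
  rw [mem_gradedPart] at *
  rw [map_pow, hv, AddMonoidAlgebra.single_pow, nsmul_eq_mul]

lemma monomial_mem (i j : ℕ) :
    x p q a b ^ i * y p q a b ^ j ∈ gradedPart p q a b ((i : ZMod p) - j) := by
  have := mul_mem_gradedPart (pow_mem_gradedPart (x_mem (p := p) (q := q) (a := a) (b := b)) i)
    (pow_mem_gradedPart y_mem j)
  rwa [mul_one, mul_neg_one, ← sub_eq_add_neg] at this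

variable (p q a b) in
/-- The projection to the homogeneous elements of degree `k`. -/
noncomputable def proj (k : ZMod p) : QWeyl p q a b →ₗ[R] QWeyl p q a b :=
  Finsupp.lapply k ∘ₗ (AddMonoidAlgebra.coeffLinearEquiv R).toLinearMap ∘ₗ
    (coaction p q a b).toLinearMap

lemma proj_apply {k l : ZMod p} {v : QWeyl p q a b} (hv : v ∈ gradedPart p q a b l) :
    proj p q a b k v = if l = k then v else 0 := by
  rw [mem_gradedPart] at hv
  simp [proj, hv, Finsupp.single_apply]

variable [NeZero p]

lemma gradedPart_le_span (hq : qInt q p = 0) (k : ZMod p) : gradedPart p q a b k ≤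
    Submodule.span R {v | ∃ i j : Fin p, ((i : ℕ) : ZMod p) - (j : ℕ) = k ∧
      v = x p q a b ^ (i : ℕ) * y p q a b ^ (j : ℕ)} := by
  intro v hv
  have h : v ∈ Submodule.span R (Set.range
    fun ij : Fin p × Fin p => x p q a b ^ (ij.1 : ℕ) * y p q a b ^ (ij.2 : ℕ)) :=
      span_monomials hq (Submodule.mem_top (x := v))
  -- Projecting an expansion of v into monomials discards those of other degrees.
  have hp : v = proj p q a b k v := by rw [proj_apply hv, if_pos rfl]
  rw [hp]
  clear hv hp
  induction h using Submodule.span_induction with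
  | mem _ h =>
    obtain ⟨⟨i, j⟩, rfl⟩ := h
    rw [proj_apply (monomial_mem _ _)]
    split_ifs with h
    · exact Submodule.subset_span ⟨i, j, h, rfl⟩
    · exact zero_mem _
  | zero => rw [map_zero]; exact zero_mem _
  | add _ _ _ _ h h' => rw [map_add]; exact add_mem h h'
  | smul s _ _ h => rw [map_smul]; exact Submodule.smul_mem _ s h

lemma iSup_gradedPart (hq : qInt q p = 0) : ⨆ k, gradedPart p q a b k = ⊤ := by
  rw [eq_top_iff]
  refine (span_monomials hq).trans (Submodule.span_le.2 ?_)
  rintro _ ⟨⟨i, j⟩, rfl⟩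
  exact Submodule.mem_iSup_of_mem _ (monomial_mem _ _)

lemma mem_gradedPart_zero (hq : qInt q p = 0) (v : QWeyl p q a b) :
    v ∈ gradedPart p q a b 0 ↔ ∃ s, QBase.toQWeyl p q a b s = v := by
  constructor
  · intro hv
    have : gradedPart p q a b 0 ≤ LinearMap.range (QBase.toQWeyl p q a b).toLinearMap := by
      refine (gradedPart_le_span hq 0).trans (Submodule.span_le.2 ?_)
      rintro _ ⟨i, j, hij, rfl⟩
      rw [sub_eq_zero, ZMod.natCast_eq_natCast_iff] at hij
      rw [hij.eq_of_lt_of_lt i.2 j.2]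
      exact ⟨_, QBase.toQWeyl_aeval j⟩
    exact this hv
  · rintro ⟨s, rfl⟩
    induction s using QBase.induction with
    | algebraMap r =>
      rw [AlgHom.commutes, Algebra.algebraMap_eq_smul_one]
      exact Submodule.smul_mem _ r one_mem_gradedPart
    | z => simpa using mul_mem_gradedPart (x_mem (p := p) (q := q) (a := a) (b := b)) y_mem
    | add s t hs ht => rw [map_add]; exact add_mem hs ht
    | mul s t hs ht => rw [map_mul]; simpa using mul_mem_gradedPart hs ht

lemma gradedPart_comm (hq : qInt q p = 0) {k : ZMod p} {v : QWeyl p q a b}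
    (hv : v ∈ gradedPart p q a b k) (s : QBase p q a b) : v * QBase.toQWeyl p q a b s =
      QBase.toQWeyl p q a b ((QBase.sigma a b hq ^ k.val) s) * v := by
  have h := gradedPart_le_span hq k hv
  clear hv
  induction h using Submodule.span_induction with
  | mem _ h =>
    obtain ⟨i, j, h, rfl⟩ := h
    exact QBase.monomial_mul_toQWeyl hq h s
  | zero => rw [mul_zero, zero_mul]
  | add _ _ _ _ h h' => rw [add_mul, h, h', mul_add]
  | smul r _ _ h => rw [mul_smul_comm, smul_mul_assoc, h]

lemma exists_toQWeyl_y_mul_x (hq : qInt q p = 0) : ∃ s : QBase p q a b,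
    QBase.toQWeyl p q a b s = y p q a b * x p q a b ∧ QBase.sigma a b hq s = QBase.z p q a b := by
  have hrq : q ^ (p - 1) * q = 1 := by
    rw [← pow_succ, Nat.sub_add_cancel (NeZero.pos p), pow_eq_one_of_qInt_eq_zero hq]
  refine ⟨q ^ (p - 1) • (QBase.z p q a b - 1), ?_, ?_⟩
  · rw [mul_swap_of_qComm hrq (comm_rel p q a b), map_smul, map_sub, map_one, QBase.toQWeyl_z,
      smul_sub]
  · rw [map_smul, map_sub, map_one, QBase.sigma_z, add_sub_cancel_left, smul_smul, hrq, one_smul]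

/-- In S this says y^n x^n = ∏ σ^(-i) z over 1 ≤ i ≤ n, with σ^n applied to clear inverses. -/
lemma exists_toQWeyl_y_pow_mul_x_pow (hq : qInt q p = 0) (n : ℕ) : ∃ s : QBase p q a b,
    QBase.toQWeyl p q a b s = y p q a b ^ n * x p q a b ^ n ∧
      (QBase.sigma a b hq ^ n) s =
        ∏ i ∈ Finset.range n, (QBase.sigma a b hq ^ i) (QBase.z p q a b) := by
  induction n with
  | zero => exact ⟨1, by simp⟩
  | succ n ih =>
    obtain ⟨s, hs, hs'⟩ := ih
    obtain ⟨t, ht, ht'⟩ := exists_toQWeyl_y_mul_x (a := a) (b := b) hq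
    obtain ⟨s, rfl⟩ := (QBase.sigma a b hq).surjective s
    refine ⟨s * t, ?_, ?_⟩
    · rw [map_mul, ht, ← mul_assoc, ← QBase.y_mul_toQWeyl hq, hs, pow_succ', pow_succ]
      simp only [mul_assoc]
    · rw [pow_succ, AlgEquiv.mul_apply, map_mul, map_mul, ht', hs', Finset.prod_range_succ]

/-- In S, y^(p-1) x^(p-1) is the product of [i] + q^i z over 0 < i < p; modulo z it is a product of
units [i], so it is comaximal with z = xy. -/
lemma one_mem_gradedPart_mul [Fact p.Prime] (hq : qInt q p = 0) :
    1 ∈ gradedPart p q a b 1 * gradedPart p q a b (-1) := by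
  obtain ⟨s, hs, hs'⟩ := exists_toQWeyl_y_pow_mul_x_pow (a := a) (b := b) hq (p - 1)
  have hs2 : s = ∏ i ∈ Finset.range (p - 1),
      (algebraMap R _ (qInt q (i + 1)) + q ^ (i + 1) • QBase.z p q a b) := by
    have := congrArg (QBase.sigma a b hq) hs'
    rw [← AlgEquiv.mul_apply, ← pow_succ', Nat.sub_add_cancel (NeZero.pos p), QBase.sigma_pow,
      map_prod] at this
    refine this.trans (Finset.prod_congr rfl fun i _ => ?_)
    rw [← AlgEquiv.mul_apply, ← pow_succ', QBase.sigma_pow_z]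
  have hco : IsCoprime (QBase.z p q a b) s := by
    rw [hs2]
    refine IsCoprime.prod_right fun i hi => ?_
    have hi' := Finset.mem_range.1 hi
    obtain ⟨u, hu⟩ := (isUnit_qInt hq (Nat.succ_pos i) (by omega)).map
      (algebraMap R (QBase p q a b))
    rw [Algebra.smul_def, mul_comm (algebraMap R _ _)]
    refine IsCoprime.add_mul_left_right ?_ _
    exact ⟨0, ((u⁻¹ : (QBase p q a b)ˣ) : QBase p q a b), by rw [← hu]; simp⟩
  obtain ⟨c, d, hcd⟩ := hco
  have h1 := congrArg (QBase.toQWeyl p q a b) hcd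
  rw [map_one, map_add, map_mul, map_mul, QBase.toQWeyl_z, hs, ← mul_assoc, ← mul_assoc] at h1
  rw [← h1]
  have hmem : ∀ (t : QBase p q a b) {k : ZMod p} {v : QWeyl p q a b}, v ∈ gradedPart p q a b k →
      QBase.toQWeyl p q a b t * v ∈ gradedPart p q a b k := fun t k v hv => by
    simpa using mul_mem_gradedPart ((mem_gradedPart_zero hq _).2 ⟨t, rfl⟩) hv
  -- Hence y^(p-1) has degree 1 and x^(p-1) has degree -1.
  have hp : ((p - 1 : ℕ) : ZMod p) = -1 := by
    rw [Nat.cast_pred (NeZero.pos p), ZMod.natCast_self, zero_sub]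
  have hy := pow_mem_gradedPart (y_mem (p := p) (q := q) (a := a) (b := b)) (p - 1)
  have hx := pow_mem_gradedPart (x_mem (p := p) (q := q) (a := a) (b := b)) (p - 1)
  rw [hp, neg_mul_neg, one_mul] at hy
  rw [hp, mul_one] at hx
  exact add_mem (Submodule.mul_mem_mul (hmem c x_mem) y_mem)
    (Submodule.mul_mem_mul (hmem d hy) hx)

/-- The grading of the algebra generated by `x` and `y`. -/
noncomputable def grading [Fact p.Prime] (a b : R) (hq : qInt q p = 0) :
    CyclicGrading (QWeyl p q a b) p (QBase.sigma a b hq) where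
  ι := QBase.toQWeyl p q a b
  part := gradedPart p q a b
  pow_eq_one := QBase.sigma_pow a b hq
  injective := QBase.toQWeyl_injective hq
  mem_zero := mem_gradedPart_zero hq
  mul_mem := mul_mem_gradedPart
  comm := gradedPart_comm hq
  one_mem := one_mem_gradedPart_mul hq
  indep f hf hsum k := by
    have := congrArg (proj p q a b k) hsum
    rw [finsum_eq_sum_of_fintype, map_zero, map_sum,
      Finset.sum_congr rfl fun l _ => proj_apply (k := k) (hf l)] at this
    simpa using this
  iSup_part := iSup_gradedPart hq

end QWeyl

/-! ### The Galois extension -/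

namespace QBase

variable {R : Type*} [CommRing R] {p : ℕ} [Fact p.Prime] {q : R} (a b : R) (hq : qInt q p = 0)
include hq

/-- With t = 1 + (q-1)z one has 1 - q^i t = -(q-1)([i] + q^i z). The product over i is 1 - t^p on
one side and (-(q-1))^p ab on the other. -/
lemma one_add_smul_z_pow : (1 + (q - 1) • z p q a b) ^ p =
    algebraMap R _ (1 + (-1) ^ (p + 1) * (a * b * (q - 1) ^ p)) := by
  have hq' : qInt (algebraMap R (QBase p q a b) q) p = 0 := by
    have := congrArg (algebraMap R (QBase p q a b)) hq
    simpa [qInt] using this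
  have h := prod_one_sub_pow_mul hq' (1 + (q - 1) • z p q a b)
  have h' : ∏ i ∈ Finset.range p,
      (1 - algebraMap R (QBase p q a b) q ^ i * (1 + (q - 1) • z p q a b)) =
      ∏ i ∈ Finset.range p, (algebraMap R (QBase p q a b) (-(q - 1)) *
        (algebraMap R _ (qInt q i) + q ^ i • z p q a b)) := by
    refine Finset.prod_congr rfl fun i _ => ?_
    have e := congrArg (algebraMap R (QBase p q a b)) (sub_one_mul_qInt q i)
    simp only [map_mul, map_sub, map_pow, map_one] at e
    simp only [Algebra.smul_def, map_neg, map_sub, map_one, map_pow]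
    linear_combination e
  rw [h', Finset.prod_mul_distrib, Finset.prod_const, Finset.card_range, ← aeval_normPoly,
    aeval_z_normPoly, ← map_pow, ← map_mul, neg_pow] at h
  have : (1 + (q - 1) • z p q a b) ^ p = 1 -
      algebraMap R (QBase p q a b) ((-1) ^ p * (q - 1) ^ p * (a * b)) := by
    rw [h, sub_sub_cancel]
  rw [this, ← map_one (algebraMap R (QBase p q a b)), ← map_sub]
  congr 1
  ring

variable (hd : IsUnit (1 + (-1) ^ (p + 1) * (a * b * (q - 1) ^ p)))
include hd

lemma isUnit_one_add_smul_z : IsUnit (1 + (q - 1) • z p q a b) := by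
  rw [← isUnit_pow_iff (Fact.out : p.Prime).ne_zero, one_add_smul_z_pow a b hq]
  exact hd.map _

lemma isUnit_sigma_sub {i j : Fin p} (hij : i < j) :
    IsUnit ((sigma a b hq ^ (j : ℕ)) (z p q a b) - (sigma a b hq ^ (i : ℕ)) (z p q a b)) := by
  obtain ⟨k, hk⟩ := Nat.exists_eq_add_of_lt (Fin.lt_def.1 hij)
  have hqu : IsUnit q := IsUnit.of_pow_eq_one (pow_eq_one_of_qInt_eq_zero hq)
    (Fact.out : p.Prime).ne_zero
  -- Here j = i + k + 1, and q^j - q^i = (q-1) q^i [k+1].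
  have e : (sigma a b hq ^ (j : ℕ)) (z p q a b) - (sigma a b hq ^ (i : ℕ)) (z p q a b) =
      algebraMap R _ (q ^ (i : ℕ) * qInt q (k + 1)) * (1 + (q - 1) • z p q a b) := by
    rw [sigma_pow_z, sigma_pow_z, hk, add_assoc, qInt_add, pow_add]
    have e1 := congrArg (algebraMap R (QBase p q a b)) (sub_one_mul_qInt q (k + 1))
    simp only [map_mul, map_sub, map_pow, map_one] at e1
    simp only [Algebra.smul_def, map_add, map_sub, map_one, map_pow, map_mul]
    linear_combination (-algebraMap R (QBase p q a b) q ^ (i : ℕ) * z p q a b) * e1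
  rw [e]
  exact (((hqu.pow _).mul (isUnit_qInt hq (Nat.succ_pos k) (by omega))).map _).mul
    (isUnit_one_add_smul_z a b hq hd)

/-- The matrix of the values of the powers of `σ` at the powers of `z`. -/
lemma isUnit_det_vandermonde : IsUnit (Matrix.vandermonde
    fun i : Fin p => (sigma a b hq ^ (i : ℕ)) (z p q a b)).det := by
  rw [Matrix.det_vandermonde]
  refine IsUnit.prod_univ_iff.2 fun i => ?_
  refine IsUnit.prod_iff.2 fun j hj => isUnit_sigma_sub a b hq hd (Finset.mem_Ioi.1 hj)

omit hd in
lemma linearMap_ext_z {M : Type*} [AddCommGroup M] [Module R M] {f g : QBase p q a b →ₗ[R] M}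
    (h : ∀ j : Fin p, f (z p q a b ^ (j : ℕ)) = g (z p q a b ^ (j : ℕ))) : f = g := by
  refine (basis a b hq).ext fun n => ?_
  rw [basis, Module.Basis.mk_apply, Polynomial.aeval_eq_sum_range'
    ((natDegree_normPoly_le q n).trans_lt n.2), map_sum, map_sum]
  refine Finset.sum_congr rfl fun j hj => ?_
  rw [map_smul, map_smul, h ⟨j, Finset.mem_range.1 hj⟩]

/-- A linear map on S is determined by its values at z^j, j < p, and ∑ c_i σ^i takes there the
entries of the row vector cV. Bijectivity thus follows from invertibility of the Vandermonde matrix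
V. -/
theorem isCyclicGalois : IsCyclicGalois R (QBase p q a b) p (sigma a b hq) where
  injective := by
    intro r s h
    have := congrArg (toQWeyl p q a b) h
    rw [AlgHom.commutes, AlgHom.commutes] at this
    exact QWeyl.algebraMap_injective a b hq this
  finite := .of_basis (basis a b hq)
  projective := .of_basis (basis a b hq)
  pow_eq_one := sigma_pow a b hq
  bijective := by
    set V := Matrix.vandermonde fun i : Fin p => (sigma a b hq ^ (i : ℕ)) (z p q a b) with hV
    have hVu := isUnit_det_vandermonde a b hq hd
    have key : ∀ (c : Fin p → QBase p q a b) (j : Fin p),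
        (∑ i : Fin p, LinearMap.mulLeft R (c i) ∘ₗ (sigma a b hq ^ (i : ℕ)).toLinearMap :
          Module.End R (QBase p q a b)) (z p q a b ^ (j : ℕ)) = Matrix.vecMul c V j := by
      intro c j
      simp [LinearMap.sum_apply, Matrix.vecMul, dotProduct, hV, Matrix.vandermonde_apply]
    constructor
    · intro c c' h
      have : Matrix.vecMul c V = Matrix.vecMul c' V := by
        ext j
        rw [← key, ← key]
        exact LinearMap.congr_fun h _
      have h2 := congrArg (fun v => Matrix.vecMul v V⁻¹) this
      simpa [Matrix.vecMul_vecMul, Matrix.mul_nonsing_inv V hVu] using h2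
    · intro f
      refine ⟨Matrix.vecMul (fun j : Fin p => f (z p q a b ^ (j : ℕ))) V⁻¹,
        linearMap_ext_z a b hq fun j => ?_⟩
      rw [key, Matrix.vecMul_vecMul, Matrix.nonsing_inv_mul V hVu, Matrix.vecMul_one]

/-- Read off the first column of V V⁻¹ = 1. -/
lemma exists_separability_element : ∃ x y : Fin p → QBase p q a b, ∀ k : ZMod p,
    ∑ i, x i * (sigma a b hq ^ k.val) (y i) = if k = 0 then 1 else 0 := by
  set V := Matrix.vandermonde fun i : Fin p => (sigma a b hq ^ (i : ℕ)) (z p q a b) with hV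
  refine ⟨fun i => V⁻¹ i 0, fun i => z p q a b ^ (i : ℕ), fun k => ?_⟩
  have h := congrFun (congrFun (Matrix.mul_nonsing_inv V (isUnit_det_vandermonde a b hq hd))
    ⟨k.val, ZMod.val_lt k⟩) 0
  rw [Matrix.mul_apply, Matrix.one_apply] at h
  have hk : (⟨k.val, ZMod.val_lt k⟩ : Fin p) = 0 ↔ k = 0 := by
    rw [Fin.ext_iff, Fin.val_zero, ZMod.val_eq_zero]
  rw [← if_congr hk rfl rfl, ← h]
  refine Finset.sum_congr rfl fun i _ => ?_
  rw [mul_comm, hV, Matrix.vandermonde_apply, map_pow]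

end QBase

/-! ### The Azumaya property is equivalent to d being a unit -/

namespace QWeyl

section Azumaya

variable {R : Type u} [CommRing R] {p : ℕ} [Fact p.Prime] {q : R} (a b : R) (hq : qInt q p = 0)
include hq

theorem isAlmostCyclic (hd : IsUnit (1 + (-1) ^ (p + 1) * (a * b * (q - 1) ^ p))) :
    IsAlmostCyclic R p (adjoinXY p q a b) := by
  rw [← QBase.range_toQWeyl]
  exact (grading a b hq).isAlmostCyclic (QBase.isCyclicGalois a b hq hd)

theorem isAzumaya (hd : IsUnit (1 + (-1) ^ (p + 1) * (a * b * (q - 1) ^ p))) :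
    IsAzumaya R (QWeyl p q a b) := by
  obtain ⟨x, y, hxy⟩ := QBase.exists_separability_element a b hq hd
  exact (grading a b hq).isAzumaya (monomialBasis a b hq) (QBase.isCyclicGalois a b hq hd) x y hxy

/-- The element `1 + (q - 1) xy` is normal. -/
lemma exists_mul_one_add_smul (w : QWeyl p q a b) :
    ∃ c, w * QBase.toQWeyl p q a b (1 + (q - 1) • QBase.z p q a b) =
      QBase.toQWeyl p q a b (1 + (q - 1) • QBase.z p q a b) * c := by
  set s := 1 + (q - 1) • QBase.z p q a b with hs
  set θ := QBase.toQWeyl p q a b s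
  -- As s is an eigenvector of σ, its image θ commutes with x and y up to powers of q.
  have hσ : QBase.sigma a b hq s = q • s := by
    rw [hs, map_add, map_one, map_smul, QBase.sigma_z, smul_add, smul_add, smul_smul, smul_smul,
      mul_comm q, ← add_assoc, ← Algebra.algebraMap_eq_smul_one, ← Algebra.algebraMap_eq_smul_one,
      map_sub, map_one, add_sub_cancel]
  have hx : x p q a b * θ = θ * (q • x p q a b) := by
    rw [QBase.x_mul_toQWeyl hq, hσ, map_smul, smul_mul_assoc, mul_smul_comm]
  have hrq : q ^ (p - 1) * q = 1 := by
    rw [← pow_succ, Nat.sub_add_cancel (NeZero.pos p), pow_eq_one_of_qInt_eq_zero hq]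
  have hy : y p q a b * θ = θ * (q ^ (p - 1) • y p q a b) := by
    rw [mul_smul_comm, ← QBase.y_mul_toQWeyl hq, hσ, map_smul, mul_smul_comm, smul_smul, hrq,
      one_smul]
  let W : Submodule R (QWeyl p q a b) :=
    { carrier := {w | ∃ c, w * θ = θ * c}
      add_mem' := fun {v w} hv hw => by
        obtain ⟨c, hc⟩ := hv
        obtain ⟨d, hd⟩ := hw
        exact ⟨c + d, by rw [add_mul, hc, hd, mul_add]⟩
      zero_mem' := ⟨0, by simp⟩
      smul_mem' := fun r w hw => by
        obtain ⟨c, hc⟩ := hw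
        exact ⟨r • c, by rw [smul_mul_assoc, hc, mul_smul_comm]⟩ }
  have hW : W = ⊤ := eq_top_of_stable W ⟨1, by simp⟩
    (fun w ⟨c, hc⟩ => ⟨q • x p q a b * c, by rw [mul_assoc, hc, ← mul_assoc, hx, mul_assoc]⟩)
    (fun w ⟨c, hc⟩ => ⟨q ^ (p - 1) • y p q a b * c, by
      rw [mul_assoc, hc, ← mul_assoc, hy, mul_assoc]⟩)
  exact hW.ge (Submodule.mem_top (x := w))

lemma coord_one_add_smul : (monomialBasis a b hq).coord (0, 0)
    (QBase.toQWeyl p q a b (1 + (q - 1) • QBase.z p q a b)) = 1 := by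
  have h1 : ((1 : Fin p) : ℕ) = 1 := by
    rw [Fin.val_one', Nat.mod_eq_of_lt (Fact.out : p.Prime).one_lt]
  have hxy : x p q a b * y p q a b = monomialBasis a b hq (1, 1) := by
    rw [monomialBasis_apply, h1, pow_one, pow_one]
  have hne : ((1, 1) : Fin p × Fin p) ≠ (0, 0) := fun h => by
    have := congrArg (fun ij => (ij.1 : ℕ)) h
    exact one_ne_zero (h1.symm.trans this)
  rw [map_add, map_one, map_smul, QBase.toQWeyl_z, map_add, coord_one, map_smul, hxy,
    Module.Basis.coord_apply, Module.Basis.repr_self, Finsupp.single_eq_of_ne' hne, smul_zero,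
    add_zero]

/-- Every combination of two-sided multiplications sends θ into θA. The endomorphism v ↦
(coefficient of 1 in v) · 1 sends θ to 1, so θ has a right inverse. -/
theorem isUnit_of_isAzumaya (h : IsAzumaya R (QWeyl p q a b)) :
    IsUnit (1 + (-1) ^ (p + 1) * (a * b * (q - 1) ^ p)) := by
  set θ := QBase.toQWeyl p q a b (1 + (q - 1) • QBase.z p q a b) with hθ
  obtain ⟨t, ht⟩ := h.bij.2
    (((monomialBasis a b hq).coord (0, 0)).smulRight (1 : QWeyl p q a b))
  have hmul : ∀ t, ∃ c, AlgHom.mulLeftRight R (QWeyl p q a b) t θ = θ * c := by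
    intro t
    induction t with
    | zero => exact ⟨0, by simp⟩
    | tmul v w =>
      obtain ⟨c, hc⟩ := exists_mul_one_add_smul a b hq v
      exact ⟨c * w.unop, by rw [AlgHom.mulLeftRight_apply, hc, mul_assoc]⟩
    | add t t' ht ht' =>
      obtain ⟨c, hc⟩ := ht
      obtain ⟨c', hc'⟩ := ht'
      exact ⟨c + c', by rw [map_add, LinearMap.add_apply, hc, hc', mul_add]⟩
  obtain ⟨c, hc⟩ := hmul t
  rw [ht, LinearMap.smulRight_apply, coord_one_add_smul, one_smul] at hc
  -- Passing to p-th powers replaces θ by the scalar d; the coefficient of 1 in d c^p = 1 then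
  -- exhibits an inverse of d in R.
  have hpow : ∀ n : ℕ, θ ^ n * c ^ n = 1 := by
    intro n
    induction n with
    | zero => simp
    | succ n ih => rw [pow_succ, pow_succ', mul_assoc, ← mul_assoc θ, ← hc, one_mul, ih]
  have hp := hpow p
  rw [hθ, ← map_pow, QBase.one_add_smul_z_pow a b hq, AlgHom.commutes, ← Algebra.smul_def] at hp
  have := congrArg ((monomialBasis a b hq).coord (0, 0)) hp
  rw [map_smul, coord_one, smul_eq_mul] at this
  exact IsUnit.of_mul_eq_one _ this

end Azumaya

/-! ### Base change, used for reduction modulo η -/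

section BaseChange

variable {R R' : Type*} [CommRing R] [CommRing R'] [Algebra R R'] {p : ℕ} [NeZero p] {q a b : R}
  {q' a' b' : R'} (hq : qInt q p = 0) (hqq : algebraMap R R' q = q') (ha : algebraMap R R' a = a')
  (hb : algebraMap R R' b = b')

/-- The comparison map of the algebra over `R'` with the base change of the algebra over `R`. -/
noncomputable def toBaseChange : QWeyl p q' a' b' →ₐ[R'] R' ⊗[R] QWeyl p q a b :=
  lift (1 ⊗ₜ x p q a b) (1 ⊗ₜ y p q a b)
    (by
      rw [Algebra.TensorProduct.tmul_mul_tmul, Algebra.TensorProduct.tmul_mul_tmul, mul_one, ← hqq,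
        algebraMap_smul, ← TensorProduct.tmul_smul, ← TensorProduct.tmul_sub, comm_rel,
        Algebra.TensorProduct.one_def])
    (by
      rw [Algebra.TensorProduct.tmul_pow, one_pow, x_pow, ← ha, Algebra.TensorProduct.algebraMap_apply,
        Algebra.algebraMap_eq_smul_one a, TensorProduct.tmul_smul, TensorProduct.smul_tmul',
        Algebra.algebraMap_eq_smul_one a, Algebra.algebraMap_self_apply])
    (by
      rw [Algebra.TensorProduct.tmul_pow, one_pow, y_pow, ← hb, Algebra.TensorProduct.algebraMap_apply,
        Algebra.algebraMap_eq_smul_one b, TensorProduct.tmul_smul, TensorProduct.smul_tmul',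
        Algebra.algebraMap_eq_smul_one b, Algebra.algebraMap_self_apply])

include hq in
lemma toBaseChange_bijective : Function.Bijective (toBaseChange (p := p) hqq ha hb) := by
  have hq' : qInt q' p = 0 := by
    have := congrArg (algebraMap R R') hq
    simpa [qInt, hqq] using this
  -- The comparison map carries one monomial basis to the other.
  let e := (monomialBasis a' b' hq').equiv ((monomialBasis a b hq).baseChange R') (Equiv.refl _)
  have he : (toBaseChange (p := p) hqq ha hb).toLinearMap = e.toLinearMap := by
    refine (monomialBasis a' b' hq').ext fun ij => ?_
    rw [LinearEquiv.coe_coe, Module.Basis.equiv_apply, Equiv.refl_apply,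
      Module.Basis.baseChange_apply, monomialBasis_apply, monomialBasis_apply]
    simp [toBaseChange]
  have : ⇑(toBaseChange (p := p) hqq ha hb) = e := congrArg DFunLike.coe he
  rw [this]
  exact e.bijective

include hq hqq ha hb in
theorem exists_baseChange_equiv : ∃ Ψ : R' ⊗[R] QWeyl p q a b ≃ₐ[R'] QWeyl p q' a' b',
    Ψ (1 ⊗ₜ x p q a b) = x p q' a' b' ∧ Ψ (1 ⊗ₜ y p q a b) = y p q' a' b' := by
  refine ⟨(AlgEquiv.ofBijective _ (toBaseChange_bijective hq hqq ha hb)).symm, ?_, ?_⟩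
  · rw [AlgEquiv.symm_apply_eq, AlgEquiv.ofBijective_apply, toBaseChange, lift_x]
  · rw [AlgEquiv.symm_apply_eq, AlgEquiv.ofBijective_apply, toBaseChange, lift_y]

end BaseChange

end QWeyl

lemma qInt_one {R : Type*} [CommRing R] (n : ℕ) : qInt (1 : R) n = n := by simp [qInt]

lemma qInt_rhoIn (p : ℕ) [Fact p.Prime] (R : Type*) [CommRing R] [Algebra (ZRho p) R] :
    qInt (rhoIn p R) p = 0 := by
  have := congrArg (algebraMap (ZRho p) R) (ZRho.qInt_root p)
  simpa only [qInt, map_sum, map_pow, map_zero, rhoIn] using this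

lemma isAzumaya_diffCrossed {p : ℕ} [Fact p.Prime] {R : Type u} [CommRing R] (hp : (p : R) = 0)
    (a b : R) : IsAzumaya R (DiffCrossed p a b) :=
  QWeyl.isAzumaya a b (by rw [qInt_one, hp]) (by simp [(Fact.out : p.Prime).ne_zero])

theorem mainTheorem7 (p : ℕ) (hp : p.Prime) {R : Type u} [CommRing R] (a b : R) :
    -- the differential crossed product `(a, b)` in characteristic `p`
    ((p : R) = 0 →
      HasMonomialBasis p 1 a b ∧
      IsAlmostCyclic R p (QWeyl.adjoinXY p 1 a b) ∧
      IsAzumaya R (DiffCrossed p a b)) ∧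
    -- the algebra `(a, b)_ρ` over a `ℤ[ρ]`-algebra
    (∀ [Algebra (ZRho p) R],
      HasMonomialBasis p (rhoIn p R) a b ∧
      (IsUnit (1 + (-1) ^ (p + 1) * (a * b * etaIn p R ^ p)) →
        IsAlmostCyclic R p (QWeyl.adjoinXY p (rhoIn p R) a b)) ∧
      (IsAzumaya R (RhoAlgebra p a b) ↔
        IsUnit (1 + (-1) ^ (p + 1) * (a * b * etaIn p R ^ p))) ∧
      -- reduction modulo `η`
      IsAzumaya (RHat p R) (DiffCrossed p (hat p a) (hat p b)) ∧
      ∃ Ψ : RHat p R ⊗[R] RhoAlgebra p a b ≃ₐ[RHat p R] DiffCrossed p (hat p a) (hat p b),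
        Ψ (1 ⊗ₜ QWeyl.x p (rhoIn p R) a b) = QWeyl.x p 1 (hat p a) (hat p b) ∧
        Ψ (1 ⊗ₜ QWeyl.y p (rhoIn p R) a b) = QWeyl.y p 1 (hat p a) (hat p b)) := by
  have : Fact p.Prime := ⟨hp⟩
  refine ⟨fun hpR => ?_, fun {_} => ?_⟩
  · have hq : qInt (1 : R) p = 0 := by rw [qInt_one, hpR]
    -- For q = 1 the term with (q-1)^p vanishes and d = 1.
    exact ⟨QWeyl.hasMonomialBasis hq, QWeyl.isAlmostCyclic a b hq (by simp [hp.ne_zero]),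
      isAzumaya_diffCrossed hpR a b⟩
  · have hq := qInt_rhoIn p R
    have hρ : algebraMap R (RHat p R) (rhoIn p R) = 1 := by
      rw [← sub_eq_zero, ← map_one (algebraMap R (RHat p R)), ← map_sub]
      exact Ideal.Quotient.eq_zero_iff_mem.2 (Ideal.mem_span_singleton_self (etaIn p R))
    -- Modulo η, ρ becomes 1 and [p] = 0 becomes p = 0.
    have hpR : (p : RHat p R) = 0 := by
      have := congrArg (algebraMap R (RHat p R)) hq
      rw [qInt, map_sum, map_zero] at this
      simpa only [map_pow, hρ, one_pow, Finset.sum_const, Finset.card_range, nsmul_one] using this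
    exact ⟨QWeyl.hasMonomialBasis hq, QWeyl.isAlmostCyclic a b hq,
      ⟨QWeyl.isUnit_of_isAzumaya a b hq, QWeyl.isAzumaya a b hq⟩,
      isAzumaya_diffCrossed hpR _ _, QWeyl.exists_baseChange_equiv hq hρ rfl rfl⟩
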